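/- **Conventions.** All functions are real valued. $(X,\mathcal B,\mu)$ denotes a standard Borel probability space, and $T_1,\dots,T_l$ are commuting invertible (bimeasurable) measure preserving transformations of $X$; for $c\in\mathbb Z^l$ write $T^c=T_1^{c_1}\cdots T_l^{c_l}$, and $Sf=f\circ S$. The system $(X,\mathcal B,\mu,(T_1,\dots,T_l))$ is *freely generated totally ergodic* if $T^c$ is ergodic for every $c\in\mathbb Z^l\setminus\{0\}$. A *polynomial family* is a matrix $P=(p_{ij})_{1\le i\le r,\,1\le j\le l}$ ($r\ge 1$) of polynomial maps $p_{ij}:\mathbb Z^d\to\mathbb Z$ (given by polynomials with rational coefficients). It is an *ED-set* if (1) no $p_{ij}$ is equal to a nonzero constant; (2) no two of the polynomials $p_{ij}$, $p_{i'j'}$ differ by a nonzero constant; (3) for every $i$ there is $j$ with $p_{ij}\ne 0$; (4) for all $i\ne i'$ there is $j$ with $p_{ij}\neq p_{i'j}$. It is *standard* if it is an ED-set and $\deg p_{1j}=\max_{i',j'}\deg p_{i'j'}$ for some $j$. For an ergodic measure preserving $S$ of $X$, the Host–Kra measures on $X^{[k]}=X^{2^k}$ are given by $\mu^{[0]}_S=\mu$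 and $\mu_S^{[k+1]}=\mu_S^{[k]}\times_{\mathcal I_S^{[k]}}\mu_S^{[k]}$, the relatively independent square of $\mu_S^{[k]}$ over the $\sigma$-algebra $\mathcal I_S^{[k]}$ of sets invariant under $S^{[k]}=S\times\dots\times S$; that is, $\int F(x')G(x'')\,d\mu_S^{[k+1]}(x',x'')=\int \mathbb E(F\mid\mathcal I_S^{[k]})\,\mathbb E(G\mid\mathcal I_S^{[k]})\,d\mu_S^{[k]}$ for bounded measurable $F,G$. For $k\ge1$ and $f\in L^\infty(\mu)$ put $|||f|||_{k,S}=\bigl(\int_{X^{[k]}}\prod_{j=0}^{2^k-1}f(x_j)\,d\mu_S^{[k]}(x)\bigr)^{1/2^k}$. A sequence $(\Phi_N)$ of finite subsets of $\mathbb Z^d$, nonempty for all large $N$, is a *Følner sequence* if $|(g+\Phi_N)\mathbin{\triangle}\Phi_N|/|\Phi_N|\to0$ for every $g\in\mathbb Z^d$. **Proposition J.** Let $P=(p_{ij})_{1\le i\le r,\,1\le j\le l}$ be a standard family of polynomials $\mathbb Z^d\to\mathbb Z$. Then there is an integer $k\ge 1$, depending only on $P$, such that the following holds for every freely generated totally ergodic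 system $(X,\mathcal B,\mu,(T_1,\dots,T_l))$. Let $c\in\mathbb Z^l\setminus\{0\}$ and $f_1,\dots,f_r\in L^\infty(\mu)$ with $|||f_1|||_{k,T^c}=0$. Then for every Følner sequence $(\Phi_N)$ in $\mathbb Z^d$ $$\limsup_{N\to\infty}\Bigl\|\frac1{|\Phi_N|}\sum_{u\in\Phi_N}\prod_{i=1}^r T_1^{p_{i1}(u)}T_2^{p_{i2}(u)}\cdots T_l^{p_{il}(u)}f_i\Bigr\|_{L^2(\mu)}=0 .$$ -/

import Mathlib

open MeasureTheory ProbabilityTheory Filter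
open scoped ENNReal Topology

/-! ### Polynomial families -/

/-- A polynomial map `ℤ^d → ℤ`: a map which is given by a polynomial with rational coefficients.
(For instance `n ↦ n * (n - 1) / 2` is allowed.) The underlying polynomial is determined by the
map. -/
structure IntPolyMap (d : ℕ) where
  /-- the map `ℤ^d → ℤ` -/
  toFun : (Fin d → ℤ) → ℤ
  /-- the polynomial that gives the map -/
  poly : MvPolynomial (Fin d) ℚ
  eval_eq : ∀ u, MvPolynomial.eval (fun i => (u i : ℚ)) poly = (toFun u : ℚ)

/-- The (total) degree of a polynomial map. -/
noncomputable def IntPolyMap.degree {d : ℕ} (p : IntPolyMap d) : ℕ := p.poly.totalDegree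

/-- The degree of a polynomial family: the maximum of the degrees of its members. -/
noncomputable def familyDegree {d r l : ℕ} (P : Fin r → Fin l → IntPolyMap d) : ℕ :=
  Finset.univ.sup fun i => Finset.univ.sup fun j => (P i j).degree

/-- ED-sets of polynomials, viewed as `r × l` matrices. -/
structure IsEDSet {d r l : ℕ} (P : Fin r → Fin l → IntPolyMap d) : Prop where
  /-- no entry is equal to a nonzero constant -/
  ne_const : ∀ i j, ¬ ∃ c : ℤ, c ≠ 0 ∧ ∀ u, (P i j).toFun u = c
  /-- no two entries differ by a nonzero constant -/
  sub_ne_const : ∀ i j i' j',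
    ¬ ∃ c : ℤ, c ≠ 0 ∧ ∀ u, (P i j).toFun u - (P i' j').toFun u = c
  /-- no row is identically zero -/
  row_ne_zero : ∀ i, ∃ j, (P i j).toFun ≠ 0
  /-- no two rows are equal -/
  rows_distinct : ∀ i i', i ≠ i' → ∃ j, (P i j).toFun ≠ (P i' j).toFun

/-- A standard polynomial family: an ED-set whose first row contains a polynomial of maximal
degree. -/
structure IsStandardFamily {d r l : ℕ} [NeZero r] (P : Fin r → Fin l → IntPolyMap d) : Prop
    extends IsEDSet P where
  exists_degree_eq : ∃ j, (P 0 j).degree = familyDegree P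

/-! ### Systems -/

/-- The transformation `T₁^{c₁} ⋯ T_l^{c_l}`. -/
def genPow {X : Type*} [MeasurableSpace X] {l : ℕ} (T : Fin l → X ≃ᵐ X) (c : Fin l → ℤ) :
    Equiv.Perm X :=
  (List.ofFn fun j => ((T j).toEquiv : Equiv.Perm X) ^ c j).prod

/-- `(X, μ, (T₁, …, T_l))` is a freely generated totally ergodic system: the `T_j` are commuting
invertible measure preserving transformations and `T₁^{c₁} ⋯ T_l^{c_l}` is ergodic for every
`c ≠ 0`. -/
structure IsFreelyGeneratedTotallyErgodic {X : Type*} [MeasurableSpace X] (μ : Measure X) {l : ℕ}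
    (T : Fin l → X ≃ᵐ X) : Prop where
  measurePreserving : ∀ j, MeasurePreserving (T j) μ μ
  commute : ∀ i j x, T i (T j x) = T j (T i x)
  ergodic : ∀ c : Fin l → ℤ, c ≠ 0 → Ergodic (genPow T c) μ

/-! ### Host-Kra measures and seminorms -/

/-- The cube `X^{[k]} = X^{2^k}`, built by `X^{[0]} = X`, `X^{[k+1]} = X^{[k]} × X^{[k]}`. -/
def Cube (X : Type*) : ℕ → Type _
  | 0 => X
  | k + 1 => Cube X k × Cube X k

instance Cube.instMeasurableSpace (X : Type*) [h : MeasurableSpace X] :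
    ∀ k, MeasurableSpace (Cube X k)
  | 0 => h
  | k + 1 => @Prod.instMeasurableSpace _ _ (Cube.instMeasurableSpace X k)
      (Cube.instMeasurableSpace X k)

instance Cube.instStandardBorelSpace (X : Type*) [MeasurableSpace X] [h : StandardBorelSpace X] :
    ∀ k, StandardBorelSpace (Cube X k)
  | 0 => h
  | k + 1 =>
    have := Cube.instStandardBorelSpace X k
    inferInstanceAs (StandardBorelSpace (Cube X k × Cube X k))

/-- The diagonal transformation `S^{[k]} = S × ⋯ × S` of `X^{[k]}`. -/
def cubeMap {X : Type*} (S : X → X) : ∀ k, Cube X k → Cube X k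
  | 0 => S
  | k + 1 => Prod.map (cubeMap S k) (cubeMap S k)

/-- The function `x ↦ ∏_{j < 2^k} f (x_j)` on `X^{[k]}`. -/
def cubeProd {X : Type*} (f : X → ℝ) : ∀ k, Cube X k → ℝ
  | 0 => f
  | k + 1 => fun x => cubeProd f k x.1 * cubeProd f k x.2

lemma measurable_condExpKernel_prod_self {Y : Type*} {m : MeasurableSpace Y}
    [mY : MeasurableSpace Y] [StandardBorelSpace Y] (ν : Measure Y) [IsFiniteMeasure ν]
    (hm : m ≤ mY) :
    Measurable fun y => (condExpKernel ν m y).prod (condExpKernel ν m y) := by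
  have h : Measurable[m] fun y => (condExpKernel ν m ×ₖ condExpKernel ν m) y :=
    (condExpKernel ν m ×ₖ condExpKernel ν m).measurable
  simp only [Kernel.prod_apply] at h
  exact h.mono hm le_rfl

/-- The relatively independent square `ν ×_m ν` of `ν` over the sub-σ-algebra `m`: the average of
the products `ν_y × ν_y`, where `(ν_y)` is the disintegration of `ν` over `m`. -/
noncomputable def relIndepSquare {Y : Type*} (m : MeasurableSpace Y) [mY : MeasurableSpace Y]
    [StandardBorelSpace Y] (ν : ProbabilityMeasure Y) (hm : m ≤ mY) :
    ProbabilityMeasure (Y × Y) :=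
  ⟨(ν : Measure Y).bind fun y =>
      (condExpKernel (ν : Measure Y) m y).prod (condExpKernel (ν : Measure Y) m y),
    isProbabilityMeasure_bind
      (measurable_condExpKernel_prod_self (ν : Measure Y) hm).aemeasurable
      (Eventually.of_forall fun _ => inferInstance)⟩

/-- Both marginals of the relatively independent square of `ν` are `ν`. -/
lemma relIndepSquare_marginals {Y : Type*} (m : MeasurableSpace Y) [mY : MeasurableSpace Y]
    [StandardBorelSpace Y] (ν : ProbabilityMeasure Y) (hm : m ≤ mY) :
    (relIndepSquare m ν hm : Measure (Y × Y)).map Prod.fst = ν ∧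
      (relIndepSquare m ν hm : Measure (Y × Y)).map Prod.snd = ν := by
  have key : ∀ s : Set Y, MeasurableSet s →
      ∫⁻ y, condExpKernel (ν : Measure Y) m y s ∂(ν : Measure Y) = (ν : Measure Y) s := by
    intro s hs
    have h := congrArg (fun ρ : Measure Y => ρ s) (condExpKernel_comp_trim (μ := (ν : Measure Y)) hm)
    rw [Measure.bind_apply hs (Kernel.aemeasurable _),
      lintegral_trim hm (measurable_condExpKernel hs)] at h
    exact h
  have hmeas := (measurable_condExpKernel_prod_self (ν : Measure Y) hm).aemeasurable
    (μ := (ν : Measure Y))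
  constructor
  · ext s hs
    rw [Measure.map_apply measurable_fst hs, ← key s hs]
    change Measure.bind _ _ _ = _
    rw [Measure.bind_apply (measurable_fst hs) hmeas]
    refine lintegral_congr fun y => ?_
    rw [← Set.prod_univ, Measure.prod_prod, measure_univ, mul_one]
  · ext s hs
    rw [Measure.map_apply measurable_snd hs, ← key s hs]
    change Measure.bind _ _ _ = _
    rw [Measure.bind_apply (measurable_snd hs) hmeas]
    refine lintegral_congr fun y => ?_
    rw [← Set.univ_prod, Measure.prod_prod, measure_univ, one_mul]

/-- The defining property of the relatively independent square. -/
theorem integral_relIndepSquare {Y : Type*} (m : MeasurableSpace Y) [mY : MeasurableSpace Y]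
    [StandardBorelSpace Y] (ν : ProbabilityMeasure Y) (hm : m ≤ mY) {F G : Y → ℝ}
    (hF : MemLp F ∞ (ν : Measure Y)) (hG : MemLp G ∞ (ν : Measure Y)) :
    ∫ x, F x.1 * G x.2 ∂(relIndepSquare m ν hm : Measure (Y × Y))
      = ∫ y, ((ν : Measure Y)[F | m]) y * ((ν : Measure Y)[G | m]) y ∂(ν : Measure Y) := by
  obtain ⟨h1, h2⟩ := relIndepSquare_marginals m ν hm
  have hF' : MemLp (fun x : Y × Y => F x.1) ∞ (relIndepSquare m ν hm : Measure (Y × Y)) :=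
    (h1.symm ▸ hF : MemLp F ∞ (Measure.map Prod.fst _)).comp_of_map measurable_fst.aemeasurable
  have hG' : MemLp (fun x : Y × Y => G x.2) ∞ (relIndepSquare m ν hm : Measure (Y × Y)) :=
    (h2.symm ▸ hG : MemLp G ∞ (Measure.map Prod.snd _)).comp_of_map measurable_snd.aemeasurable
  have hint : Integrable (fun x : Y × Y => F x.1 * G x.2)
      (relIndepSquare m ν hm : Measure (Y × Y)) :=
    ((hG'.mul (r := ∞) hF')).integrable le_top
  let η : Kernel Y (Y × Y) :=
    ⟨fun y => (condExpKernel (ν : Measure Y) m y).prod (condExpKernel (ν : Measure Y) m y),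
      measurable_condExpKernel_prod_self (ν : Measure Y) hm⟩
  have hη : (relIndepSquare m ν hm : Measure (Y × Y))
      = (η ∘ₖ Kernel.const Unit (ν : Measure Y)) () := rfl
  rw [hη] at hint ⊢
  rw [Kernel.integral_comp hint, Kernel.const_apply]
  have e1 := condExp_ae_eq_integral_condExpKernel hm (hF.integrable le_top)
  have e2 := condExp_ae_eq_integral_condExpKernel hm (hG.integrable le_top)
  refine integral_congr_ae ?_
  filter_upwards [e1, e2] with y hy1 hy2
  rw [hy1, hy2]
  exact integral_prod_mul F G

/-- The Host-Kra measures `μ^{[k]}_S`: `μ^{[0]} = μ`, and `μ^{[k+1]}` is the relatively independent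
square of `μ^{[k]}` over the σ-algebra of `S^{[k]}`-invariant sets. -/
noncomputable def hostKraMeasure {X : Type*} [MeasurableSpace X] [StandardBorelSpace X]
    (μ : ProbabilityMeasure X) (S : X → X) : ∀ k, ProbabilityMeasure (Cube X k)
  | 0 => μ
  | k + 1 => relIndepSquare (MeasurableSpace.invariants (cubeMap S k)) (hostKraMeasure μ S k)
      (MeasurableSpace.invariants_le _)

/-- The Host-Kra seminorm `|||f|||_{k,S}`, for `k ≥ 1`. -/
noncomputable def hostKraSeminorm {X : Type*} [MeasurableSpace X] [StandardBorelSpace X]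
    (μ : ProbabilityMeasure X) (S : X → X) (k : ℕ) (f : X → ℝ) : ℝ :=
  (∫ x, cubeProd f k x ∂(hostKraMeasure μ S k : Measure (Cube X k))) ^ (1 / 2 ^ k : ℝ)

/-! ### Averages -/

/-- The average `(1 / |Φ|) ∑_{u ∈ Φ} ∏_i T₁^{p_{i1}(u)} ⋯ T_l^{p_{il}(u)} f_i`. -/
noncomputable def polyAverage {X : Type*} [MeasurableSpace X] {d r l : ℕ} (T : Fin l → X ≃ᵐ X)
    (P : Fin r → Fin l → IntPolyMap d) (f : Fin r → X → ℝ) (Φ : Finset (Fin d → ℤ)) (x : X) : ℝ :=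
  (1 / (Φ.card : ℝ)) * ∑ u ∈ Φ, ∏ i, f i (genPow T (fun j => (P i j).toFun u) x)

/-! The proof replaces the Host–Kra seminorm by a finite quantity that does not see the direction
`c`, and then runs van der Corput (PET) induction on the polynomial family.

The finite quantity is `boxAvg`, an average of cube correlations of `f` over finite boxes with
prescribed directions and dyadic sides. If the Host–Kra integral of `f` for `T^c` vanishes, the box
averages with all directions equal to `c` become arbitrarily small: each conditional expectation in
the definition of the Host–Kra measures is reached by ergodic averages, and box averages only
decrease as their sides double (`eventually_boxAvg_le_integral_cubeProd`). Total ergodicity makes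
the directions irrelevant. For an ergodic direction the innermost average is close to `(∫ F)²`,
which by Cauchy–Schwarz is at most the innermost average in any other direction, so directions can
be exchanged one at a time (`exists_boxAvg_lt_of_directions`). Hence `f` satisfies `IsBoxNull`, for
all systems of `k` nonzero directions at once.

For families of degree one, van der Corput and Cauchy–Schwarz remove the functions other than the
tracked one successively, each at the cost of one direction; what remains is a box average of the
tracked function, in nonzero directions that depend only on the linear parts
(`exists_directions_of_linear`).

For higher degree, a van der Corput step passes to the differences `p i (u + a) - p m (u + b)` and
`p i (u + b) - p m (u + b)`. If `p m` has minimal degree in the family, the vector counting the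
classes of polynomials of each degree drops lexicographically, highest degree first
(`HasWeight.vdcFamily`, `reducedWeight_lex`). The pivot `m` can be chosen so that the tracked
polynomial keeps the maximal degree (`IsLeading.exists_pivot`), and for all but a negligible
proportion of the shifts it stays essentially distinct from the other members
(`exists_card_bad_le`). The weight and the number of members alone bound the order of nullness
needed, so the recursion in `exists_controlsFamilies` yields a `k` independent of the system and of
the functions. -/

/-! ### Bounded measurable functions -/

/-- Measurable functions bounded by `1`. -/
structure UnitBdd {X : Type*} [MeasurableSpace X] (f : X → ℝ) : Prop where
  measurable : Measurable f
  abs_le : ∀ x, |f x| ≤ 1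

namespace UnitBdd

variable {X : Type*} [MeasurableSpace X] {f g : X → ℝ}

lemma mul (hf : UnitBdd f) (hg : UnitBdd g) : UnitBdd fun x => f x * g x where
  measurable := hf.measurable.mul hg.measurable
  abs_le x := by
    rw [abs_mul]
    exact mul_le_one₀ (hf.abs_le x) (abs_nonneg _) (hg.abs_le x)

lemma comp {Y : Type*} [MeasurableSpace Y] (hf : UnitBdd f) {S : Y → X} (hS : Measurable S) :
    UnitBdd fun x => f (S x) :=
  ⟨hf.measurable.comp hS, fun x => hf.abs_le (S x)⟩

lemma const {a : ℝ} (ha : |a| ≤ 1) : UnitBdd fun _ : X => a := ⟨measurable_const, fun _ => ha⟩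

lemma prod {ι : Type*} (s : Finset ι) {f : ι → X → ℝ} (hf : ∀ i ∈ s, UnitBdd (f i)) :
    UnitBdd fun x => ∏ i ∈ s, f i x where
  measurable := Finset.measurable_fun_prod s fun i hi => (hf i hi).measurable
  abs_le x := by
    rw [Finset.abs_prod]
    exact Finset.prod_le_one (fun _ _ => abs_nonneg _) fun i hi => (hf i hi).abs_le x

/-- An average of functions bounded by `1` is bounded by `1`. -/
lemma average {ι : Type*} (s : Finset ι) {f : ι → X → ℝ} (hf : ∀ i ∈ s, UnitBdd (f i)) :
    UnitBdd fun x => (1 / (s.card : ℝ)) * ∑ i ∈ s, f i x where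
  measurable := (Finset.measurable_fun_sum s fun i hi => (hf i hi).measurable).const_mul _
  abs_le x := by
    rw [abs_mul, abs_of_nonneg (by positivity)]
    have h : |∑ i ∈ s, f i x| ≤ s.card := by
      refine (Finset.abs_sum_le_sum_abs _ _).trans ?_
      simpa using Finset.sum_le_sum fun i hi => (hf i hi).abs_le x
    calc 1 / (s.card : ℝ) * |∑ i ∈ s, f i x| ≤ 1 / (s.card : ℝ) * s.card := by gcongr
      _ ≤ 1 := by rw [one_div]; exact inv_mul_le_one

lemma integrable (hf : UnitBdd f) (μ : Measure X) [IsFiniteMeasure μ] : Integrable f μ :=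
  Integrable.of_bound hf.measurable.aestronglyMeasurable 1
    (Eventually.of_forall fun x => by simpa using hf.abs_le x)

lemma memLp (hf : UnitBdd f) (μ : Measure X) [IsFiniteMeasure μ] (p : ℝ≥0∞) : MemLp f p μ :=
  MemLp.of_bound hf.measurable.aestronglyMeasurable 1
    (Eventually.of_forall fun x => by simpa using hf.abs_le x)

lemma sq (hf : UnitBdd f) : UnitBdd fun x => f x ^ 2 := by
  simpa only [pow_two] using hf.mul hf

lemma abs_integral_le (hf : UnitBdd f) (μ : Measure X) [IsProbabilityMeasure μ] :
    |∫ x, f x ∂μ| ≤ 1 := by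
  have := norm_integral_le_of_norm_le_const (μ := μ) (f := f) (C := 1)
    (Eventually.of_forall fun x => by simpa using hf.abs_le x)
  simpa using this

lemma sq_integral_le (hf : UnitBdd f) (μ : Measure X) [IsProbabilityMeasure μ] :
    (∫ x, f x ∂μ) ^ 2 ≤ ∫ x, f x ^ 2 ∂μ := by
  have h := variance_nonneg f μ
  rw [variance_eq_sub (hf.memLp μ 2)] at h
  simpa using h

end UnitBdd

/-- The square of an average is at most the average of the squares. -/
lemma sq_average_le {ι : Type*} (s : Finset ι) (f : ι → ℝ) :
    ((1 / (s.card : ℝ)) * ∑ i ∈ s, f i) ^ 2 ≤ (1 / (s.card : ℝ)) * ∑ i ∈ s, f i ^ 2 := by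
  rcases s.eq_empty_or_nonempty with rfl | hs
  · simp
  have hc : (0 : ℝ) < s.card := by exact_mod_cast hs.card_pos
  have := sq_sum_le_card_mul_sum_sq (s := s) (f := f)
  rw [mul_pow, div_pow, one_pow, div_mul_eq_mul_div, one_mul, div_mul_eq_mul_div, one_mul,
    div_le_div_iff₀ (by positivity) hc]
  nlinarith

/-! ### Measure preserving actions -/

/-- A measure preserving action, given by the maps `φ c`, in which all `φ c` with `c ≠ 0` are
ergodic. -/
structure IsErgodicAction {Γ X : Type*} [AddCommGroup Γ] [MeasurableSpace X] (μ : Measure X)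
    (φ : Γ → X → X) : Prop where
  zero_apply : ∀ x, φ 0 x = x
  add_apply : ∀ a b x, φ (a + b) x = φ a (φ b x)
  measurePreserving : ∀ c, MeasurePreserving (φ c) μ μ
  ergodic : ∀ c, c ≠ 0 → Ergodic (φ c) μ

namespace IsErgodicAction

variable {Γ X : Type*} [AddCommGroup Γ] [MeasurableSpace X] {μ : Measure X} {φ : Γ → X → X}

lemma measurable (h : IsErgodicAction μ φ) (c : Γ) : Measurable (φ c) :=
  (h.measurePreserving c).measurable

lemma integral_comp (h : IsErgodicAction μ φ) (c : Γ) {f : X → ℝ} (hf : Measurable f) :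
    ∫ x, f (φ c x) ∂μ = ∫ x, f x ∂μ := by
  have e := (h.measurePreserving c).map_eq
  conv_rhs => rw [← e]
  rw [integral_map (h.measurable c).aemeasurable hf.aestronglyMeasurable]

lemma nsmul_apply (h : IsErgodicAction μ φ) (c : Γ) (n : ℕ) (x : X) :
    φ (n • c) x = (φ c)^[n] x := by
  induction n with
  | zero => simp [h.zero_apply]
  | succ n ih => rw [add_smul, one_smul, add_comm, h.add_apply, ih, Function.iterate_succ_apply']

end IsErgodicAction

/-! ### Box averages -/

/-- The box averages of `f`, for a list of directions and (dyadic) side lengths. -/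
noncomputable def boxAvg {Γ X : Type*} [AddCommGroup Γ] [MeasurableSpace X] (μ : Measure X)
    (φ : Γ → X → X) : List (Γ × ℕ) → (X → ℝ) → ℝ
  | [], f => ∫ x, f x ∂μ
  | (c, j) :: L, f => (1 / ((2 ^ j * 2 ^ j : ℕ) : ℝ)) *
      ∑ q ∈ Finset.range (2 ^ j) ×ˢ Finset.range (2 ^ j),
        boxAvg μ φ L fun x => f (φ (q.1 • c) x) * f (φ (q.2 • c) x)

section BoxAvg

variable {Γ X : Type*} [AddCommGroup Γ] [MeasurableSpace X] {μ : Measure X}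
  {φ : Γ → X → X} {f : X → ℝ}

lemma UnitBdd.boxFactor (h : IsErgodicAction μ φ) (hf : UnitBdd f) (a b : Γ) :
    UnitBdd fun x => f (φ a x) * f (φ b x) :=
  (hf.comp (h.measurable a)).mul (hf.comp (h.measurable b))

/-- Averaging over pairs of shifts is the expansion of a square. Through this identity the mean
ergodic theorem and convexity apply to the innermost direction of any box average. -/
lemma boxAvg_singleton [IsProbabilityMeasure μ] (h : IsErgodicAction μ φ) (hf : UnitBdd f) (c : Γ)
    (j : ℕ) :
    boxAvg μ φ [(c, j)] f =
      ∫ x, ((1 / ((2 ^ j : ℕ) : ℝ)) * ∑ n ∈ Finset.range (2 ^ j), f (φ (n • c) x)) ^ 2 ∂μ := by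
  simp only [boxAvg]
  rw [← integral_finsetSum _ fun q _ => (hf.boxFactor h _ _).integrable μ,
    ← integral_const_mul]
  congr 1
  ext x
  rw [mul_pow, pow_two (Finset.sum _ _), Finset.sum_mul_sum, Finset.sum_product]
  push_cast
  ring

/-- The action is commutative, so both orders produce the same four translates of `f`. Any direction
can therefore be moved to the innermost place, where it acts on an actual square. -/
lemma boxAvg_swap (h : IsErgodicAction μ φ) (x y : Γ × ℕ) (L : List (Γ × ℕ)) (f : X → ℝ) :
    boxAvg μ φ (x :: y :: L) f = boxAvg μ φ (y :: x :: L) f := by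
  obtain ⟨a, i⟩ := x
  obtain ⟨b, j⟩ := y
  simp only [boxAvg, Finset.mul_sum]
  rw [Finset.sum_comm]
  refine Finset.sum_congr rfl fun q _ => Finset.sum_congr rfl fun p _ => ?_
  have e : (fun x => f (φ (p.1 • a) (φ (q.1 • b) x)) * f (φ (p.2 • a) (φ (q.1 • b) x)) *
        (f (φ (p.1 • a) (φ (q.2 • b) x)) * f (φ (p.2 • a) (φ (q.2 • b) x))))
      = fun x => f (φ (q.1 • b) (φ (p.1 • a) x)) * f (φ (q.2 • b) (φ (p.1 • a) x)) *
        (f (φ (q.1 • b) (φ (p.2 • a) x)) * f (φ (q.2 • b) (φ (p.2 • a) x))) := by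
    ext x
    simp only [← h.add_apply]
    rw [add_comm (q.1 • b), add_comm (q.1 • b), add_comm (q.2 • b), add_comm (q.2 • b)]
    ring
  rw [e]
  ring

lemma boxAvg_cons_congr {L L' : List (Γ × ℕ)} (hL : ∀ f, boxAvg μ φ L f = boxAvg μ φ L' f)
    (x : Γ × ℕ) (f : X → ℝ) : boxAvg μ φ (x :: L) f = boxAvg μ φ (x :: L') f := by
  obtain ⟨a, i⟩ := x
  simp only [boxAvg, hL]

lemma boxAvg_perm (h : IsErgodicAction μ φ) {L L' : List (Γ × ℕ)} (hL : L.Perm L') :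
    ∀ f, boxAvg μ φ L f = boxAvg μ φ L' f := by
  induction hL with
  | nil => exact fun _ => rfl
  | cons x _ ih => exact boxAvg_cons_congr ih x
  | swap x y l => exact boxAvg_swap h _ _ _
  | trans _ _ h1 h2 => exact fun f => (h1 f).trans (h2 f)

/-- Comparison of box averages, from a comparison for the innermost averages. -/
lemma boxAvg_append_le (h : IsErgodicAction μ φ) {K K' : List (Γ × ℕ)}
    (hK : ∀ f, UnitBdd f → boxAvg μ φ K f ≤ boxAvg μ φ K' f) (L : List (Γ × ℕ)) :
    ∀ f, UnitBdd f → boxAvg μ φ (L ++ K) f ≤ boxAvg μ φ (L ++ K') f := by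
  induction L with
  | nil => exact hK
  | cons x L ih =>
    obtain ⟨a, i⟩ := x
    intro f hf
    simp only [List.cons_append, boxAvg]
    gcongr
    exact ih _ (hf.boxFactor h _ _)

/-- An average of length `2 ^ (j + 1)` is the mean of an average `g` of length `2 ^ j` and a
translate of `g`; convexity of the square and invariance of `μ` give the bound. This halving is the
reason for dyadic sides. -/
lemma boxAvg_singleton_succ_le [IsProbabilityMeasure μ] (h : IsErgodicAction μ φ) (hf : UnitBdd f)
    (c : Γ) (j : ℕ) : boxAvg μ φ [(c, j + 1)] f ≤ boxAvg μ φ [(c, j)] f := by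
  rw [boxAvg_singleton h hf, boxAvg_singleton h hf]
  set g : X → ℝ := fun x =>
    (1 / ((2 ^ j : ℕ) : ℝ)) * ∑ n ∈ Finset.range (2 ^ j), f (φ (n • c) x) with hg
  have hgu : UnitBdd g := by
    simpa [hg] using
      UnitBdd.average (Finset.range (2 ^ j)) fun n _ => hf.comp (h.measurable (n • c))
  have e : ∀ x, (1 / ((2 ^ (j + 1) : ℕ) : ℝ)) *
      ∑ n ∈ Finset.range (2 ^ (j + 1)), f (φ (n • c) x) = (g x + g (φ (2 ^ j • c) x)) / 2 := by
    intro x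
    rw [pow_succ, mul_two, Finset.sum_range_add]
    simp only [hg, ← h.add_apply, ← add_smul, add_comm (2 ^ j)]
    push_cast
    field_simp
    ring
  simp_rw [e]
  have h1 : ∀ x, ((g x + g (φ (2 ^ j • c) x)) / 2) ^ 2
      ≤ (1 / 2) * (g x ^ 2 + g (φ (2 ^ j • c) x) ^ 2) := fun x => by
    nlinarith [sq_nonneg (g x - g (φ (2 ^ j • c) x))]
  have hgc : UnitBdd fun x => g (φ (2 ^ j • c) x) := hgu.comp (h.measurable _)
  have hu : UnitBdd fun x => (g x + g (φ (2 ^ j • c) x)) / 2 := by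
    refine ⟨(hgu.measurable.add hgc.measurable).div_const _, fun x => ?_⟩
    rw [abs_le]
    have := abs_le.1 (hgu.abs_le x)
    have := abs_le.1 (hgc.abs_le x)
    constructor <;> linarith
  calc ∫ x, ((g x + g (φ (2 ^ j • c) x)) / 2) ^ 2 ∂μ
      ≤ ∫ x, (1 / 2) * (g x ^ 2 + g (φ (2 ^ j • c) x) ^ 2) ∂μ :=
        integral_mono (hu.sq.integrable μ)
          (((hgu.sq.integrable μ).add (hgc.sq.integrable μ)).const_mul _) h1
    _ = ∫ x, g x ^ 2 ∂μ := by
        rw [integral_const_mul, integral_add (hgu.sq.integrable μ) (hgc.sq.integrable μ),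
          h.integral_comp _ hgu.sq.measurable]
        ring

lemma boxAvg_singleton_anti [IsProbabilityMeasure μ] (h : IsErgodicAction μ φ) (hf : UnitBdd f)
    (c : Γ) {i j : ℕ} (hij : i ≤ j) : boxAvg μ φ [(c, j)] f ≤ boxAvg μ φ [(c, i)] f := by
  induction hij with
  | refl => exact le_rfl
  | step _ ih => exact (boxAvg_singleton_succ_le h hf c _).trans ih

/-- Box averages decrease when the side lengths grow. -/
lemma boxAvg_anti [IsProbabilityMeasure μ] (h : IsErgodicAction μ φ) {L L' : List (Γ × ℕ)}
    (hL : List.Forall₂ (fun x y => x.1 = y.1 ∧ x.2 ≤ y.2) L L') :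
    ∀ f, UnitBdd f → boxAvg μ φ L' f ≤ boxAvg μ φ L f := by
  induction hL with
  | nil => exact fun _ _ => le_rfl
  | @cons x y L L' hxy _ ih =>
    obtain ⟨a, i⟩ := x
    obtain ⟨b, j⟩ := y
    obtain ⟨rfl, hij : i ≤ j⟩ := hxy
    intro f hf
    calc boxAvg μ φ ((a, j) :: L') f ≤ boxAvg μ φ ((a, j) :: L) f :=
          boxAvg_append_le h ih [(a, j)] f hf
      _ = boxAvg μ φ (L ++ [(a, j)]) f := boxAvg_perm h (List.perm_append_singleton _ _).symm f
      _ ≤ boxAvg μ φ (L ++ [(a, i)]) f :=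
          boxAvg_append_le h (fun f hf => boxAvg_singleton_anti h hf a hij) L f hf
      _ = boxAvg μ φ ((a, i) :: L) f := boxAvg_perm h (List.perm_append_singleton _ _) f

/-- Cauchy–Schwarz: with the new direction innermost, the base case compares the squared mean of an
ergodic average with its second moment, and each outer direction costs one more use of convexity. -/
lemma sq_boxAvg_le [IsProbabilityMeasure μ] (h : IsErgodicAction μ φ) (x : Γ × ℕ)
    (L : List (Γ × ℕ)) : ∀ f, UnitBdd f → boxAvg μ φ L f ^ 2 ≤ boxAvg μ φ (x :: L) f := by
  suffices H : ∀ f, UnitBdd f → boxAvg μ φ L f ^ 2 ≤ boxAvg μ φ (L ++ [x]) f from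
    fun f hf => (H f hf).trans_eq (boxAvg_perm h (List.perm_append_singleton _ _) f)
  induction L with
  | nil =>
    intro f hf
    obtain ⟨c, j⟩ := x
    have hj : ((2 ^ j : ℕ) : ℝ) ≠ 0 := by positivity
    have hgu : UnitBdd fun x =>
        (1 / ((2 ^ j : ℕ) : ℝ)) * ∑ n ∈ Finset.range (2 ^ j), f (φ (n • c) x) := by
      simpa using UnitBdd.average (Finset.range (2 ^ j)) fun n _ => hf.comp (h.measurable (n • c))
    simp only [List.nil_append]
    rw [boxAvg_singleton h hf]
    refine le_trans (le_of_eq ?_) (hgu.sq_integral_le μ)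
    rw [integral_const_mul,
      integral_finsetSum _ fun n _ => (hf.comp (h.measurable (n • c))).integrable μ]
    simp only [h.integral_comp _ hf.measurable, boxAvg, Finset.sum_const, Finset.card_range,
      nsmul_eq_mul]
    field_simp
  | cons y L ih =>
    obtain ⟨c, j⟩ := y
    intro f hf
    simp only [List.cons_append, boxAvg]
    have := sq_average_le (Finset.range (2 ^ j) ×ˢ Finset.range (2 ^ j)) fun q =>
      boxAvg μ φ L fun x => f (φ (q.1 • c) x) * f (φ (q.2 • c) x)
    rw [Finset.card_product, Finset.card_range] at this
    refine this.trans ?_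
    gcongr
    exact ih _ (hf.boxFactor h _ _)

end BoxAvg

/-- `f` is null of order `k` if its box averages over all systems of `k` nonzero directions become
arbitrarily small. -/
def IsBoxNull {Γ X : Type*} [AddCommGroup Γ] [MeasurableSpace X] (μ : Measure X)
    (φ : Γ → X → X) (k : ℕ) (f : X → ℝ) : Prop :=
  ∀ cs : List Γ, cs.length = k → (∀ c ∈ cs, c ≠ 0) → ∀ ε > 0,
    ∃ L : List (Γ × ℕ), L.map Prod.fst = cs ∧ boxAvg μ φ L f < ε

/-! ### The mean ergodic theorem -/

/-- A function which is invariant almost everywhere agrees almost everywhere with a function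
measurable with respect to the σ-algebra of invariant sets. -/
lemma exists_stronglyMeasurable_invariants_ae_eq {Y : Type*} [MeasurableSpace Y] {ν : Measure Y}
    {S : Y → Y} (hS : MeasurePreserving S ν ν) {g : Y → ℝ} (hg : AEStronglyMeasurable g ν)
    (hgS : g ∘ S =ᵐ[ν] g) :
    ∃ g' : Y → ℝ, StronglyMeasurable[MeasurableSpace.invariants S] g' ∧ g' =ᵐ[ν] g := by
  obtain ⟨h, hm, hgh⟩ := hg
  have hh : h ∘ S =ᵐ[ν] h :=
    ((hS.quasiMeasurePreserving.ae_eq_comp hgh).symm.trans hgS).trans hgh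
  have hn : ∀ n, (fun x => h (S^[n] x)) =ᵐ[ν] h := by
    intro n
    induction n with
    | zero => rfl
    | succ n ih =>
      exact (hS.quasiMeasurePreserving.ae_eq_comp ih).trans hh
  -- The upper limit along an orbit does not change when the orbit is shifted, so it is invariant
  -- everywhere and not only almost everywhere, as measurability for `MeasurableSpace.invariants S`
  -- demands.
  refine ⟨fun x => limsup (fun n => h (S^[n] x)) atTop, ?_, ?_⟩
  · refine Measurable.stronglyMeasurable (MeasurableSpace.measurable_invariants_dom.2 ⟨?_, ?_⟩)
    · exact Measurable.limsup fun n => hm.measurable.comp (hS.measurable.iterate n)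
    · intro s _
      congr 1
      ext x
      exact limsup_nat_add (fun n => h (S^[n] x)) 1
  · filter_upwards [ae_all_iff.2 hn, hgh] with x hx hx'
    simp only [hx, limsup_const]
    exact hx'.symm

lemma integral_mul_condExp {Y : Type*} {m : MeasurableSpace Y} [mY : MeasurableSpace Y]
    {ν : Measure Y} [IsFiniteMeasure ν] (hm : m ≤ mY) {F g : Y → ℝ} (hF : Integrable F ν)
    (hg : StronglyMeasurable[m] g) (hgF : Integrable (g * F) ν) :
    ∫ x, g x * (ν[F | m]) x ∂ν = ∫ x, g x * F x ∂ν := by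
  calc ∫ x, g x * (ν[F | m]) x ∂ν = ∫ x, (ν[g * F | m]) x ∂ν :=
        integral_congr_ae (condExp_mul_of_stronglyMeasurable_left hg hgF hF).symm
    _ = _ := integral_condExp hm

/-- The upper bound in the mean ergodic theorem, in terms of the conditional expectation on the
invariant σ-algebra. -/
theorem eventually_integral_sq_ergodicAverage_le {Y : Type*} [MeasurableSpace Y] {ν : Measure Y}
    [IsProbabilityMeasure ν] {S : Y → Y} (hS : MeasurePreserving S ν ν) {F : Y → ℝ}
    (hF : UnitBdd F) {ε : ℝ} (hε : 0 < ε) :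
    ∀ᶠ H : ℕ in atTop,
      ∫ x, ((1 / (H : ℝ)) * ∑ n ∈ Finset.range H, F (S^[n] x)) ^ 2 ∂ν
        ≤ ∫ x, (ν[F | MeasurableSpace.invariants S]) x ^ 2 ∂ν + ε := by
  have hF2 := hF.memLp ν 2
  let U : Lp ℝ 2 ν →L[ℝ] Lp ℝ 2 ν := (Lp.compMeasurePreservingₗᵢ ℝ S hS).toContinuousLinearMap
  have hU1 : ‖U‖ ≤ 1 := LinearIsometry.norm_toContinuousLinearMap_le _
  have hUn : ∀ n, U^[n] (hF2.toLp F) =ᵐ[ν] fun x => F (S^[n] x) := by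
    intro n
    have : U^[n] (hF2.toLp F) = (hF2.comp_measurePreserving (hS.iterate n)).toLp _ := by
      change (Lp.compMeasurePreserving S hS)^[n] _ = _
      rw [Lp.compMeasurePreserving_iterate]
      rfl
    rw [this]
    exact MemLp.coeFn_toLp _
  have hav : ∀ H : ℕ, ⇑(birkhoffAverage ℝ U _root_.id H (hF2.toLp F) : Lp ℝ 2 ν) =ᵐ[ν]
      fun x => (1 / (H : ℝ)) * ∑ n ∈ Finset.range H, F (S^[n] x) := by
    intro H
    rw [birkhoffAverage, birkhoffSum]
    refine (Lp.coeFn_smul _ _).trans ?_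
    filter_upwards [Lp.coeFn_finsetSum (Finset.range H) fun n => U^[n] (hF2.toLp F),
      ae_all_iff.2 hUn] with x hx hx'
    simp only [Pi.smul_apply, id_eq, smul_eq_mul, one_div]
    rw [hx, Finset.sum_apply]
    simp only [hx']
  have hnorm : ∀ g : Lp ℝ 2 ν, ‖g‖ ^ 2 = ∫ x, g x ^ 2 ∂ν := by
    intro g
    rw [← real_inner_self_eq_norm_sq, L2.inner_def]
    simp [pow_two]
  -- Von Neumann's theorem for the Koopman operator: the averages converge to the projection `p`
  -- onto the fixed vectors. Only `‖p‖² ≤ ∫ E²` is needed from here on, not the equality of `p` and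
  -- `E`.
  have hlim := U.tendsto_birkhoffAverage_orthogonalProjection hU1 (hF2.toLp F)
  set K := U.eqLocus (1 : Lp ℝ 2 ν →L[ℝ] Lp ℝ 2 ν) with hK
  set p : Lp ℝ 2 ν := ((K.orthogonalProjectionOnto (hF2.toLp F) : K) : Lp ℝ 2 ν) with hp
  have hpK : U p = p := (K.orthogonalProjectionOnto (hF2.toLp F)).2
  have hpS : (p : Y → ℝ) ∘ S =ᵐ[ν] p := by
    have := Lp.coeFn_compMeasurePreserving p hS
    exact this.symm.trans (by change (U p : Y → ℝ) =ᵐ[ν] p; rw [hpK])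
  obtain ⟨g, hgm, hgp⟩ := exists_stronglyMeasurable_invariants_ae_eq hS
    (Lp.aestronglyMeasurable p) hpS
  set E := ν[F | MeasurableSpace.invariants S] with hE
  have hg2 : MemLp g 2 ν := (memLp_congr_ae hgp).2 (Lp.memLp p)
  have hE2 : MemLp E 2 ν := hF2.condExp one_le_two
  have hpn : ‖p‖ ^ 2 = ∫ x, g x ^ 2 ∂ν := by
    rw [hnorm]
    exact integral_congr_ae (by filter_upwards [hgp] with x hx; rw [hx])
  have hpF : ‖p‖ ^ 2 = ∫ x, g x * F x ∂ν := by
    have h1 : inner ℝ (hF2.toLp F) p = ‖p‖ ^ 2 := by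
      rw [← real_inner_self_eq_norm_sq]
      have := Submodule.starProjection_inner_eq_zero (K := K) (hF2.toLp F) p hpK
      rw [inner_sub_left, sub_eq_zero] at this
      exact this
    rw [← h1, L2.inner_def]
    refine integral_congr_ae ?_
    filter_upwards [hgp, hF2.coeFn_toLp] with x hx hx'
    rw [hx, hx']
    simp
  have hgE : ∫ x, g x * E x ∂ν = ‖p‖ ^ 2 := by
    rw [hpF]
    exact integral_mul_condExp (MeasurableSpace.invariants_le S) (hF.integrable ν) hgm
      (hg2.integrable_mul hF2)
  -- Since `∫ g E = ∫ g²`, expanding `∫ (E - g)² ≥ 0` leaves `∫ E² - ∫ g²`.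
  have hle : ‖p‖ ^ 2 ≤ ∫ x, E x ^ 2 ∂ν := by
    have h0 : 0 ≤ ∫ x, (E x - g x) ^ 2 ∂ν := integral_nonneg fun x => sq_nonneg _
    have e : ∫ x, (E x - g x) ^ 2 ∂ν = ∫ x, (E x ^ 2 - 2 * (g x * E x) + g x ^ 2) ∂ν := by
      congr 1; ext x; ring
    have i1 : Integrable (fun x => 2 * (g x * E x)) ν := (hg2.integrable_mul hE2).const_mul 2
    rw [e, integral_add (f := fun x => E x ^ 2 - 2 * (g x * E x)) (hE2.integrable_sq.sub i1)
      hg2.integrable_sq, integral_sub hE2.integrable_sq i1, integral_const_mul, hgE, ← hpn] at h0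
    linarith
  have hlim2 := (hlim.norm.pow 2).eventually_le_const (u := ‖p‖ ^ 2 + ε) (by linarith)
  filter_upwards [hlim2] with H hH
  rw [hnorm] at hH
  have e : ∫ x, ((1 / (H : ℝ)) * ∑ n ∈ Finset.range H, F (S^[n] x)) ^ 2 ∂ν
      = ∫ x, (birkhoffAverage ℝ U _root_.id H (hF2.toLp F) : Lp ℝ 2 ν) x ^ 2 ∂ν :=
    integral_congr_ae (by filter_upwards [hav H] with x hx; rw [hx])
  rw [e]
  linarith

/-- The upper bound in the mean ergodic theorem for an ergodic transformation. -/
lemma eventually_integral_sq_ergodicAverage_le_of_ergodic {Y : Type*} [MeasurableSpace Y]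
    {ν : Measure Y} [IsProbabilityMeasure ν] {S : Y → Y} (hS : Ergodic S ν) {F : Y → ℝ}
    (hF : UnitBdd F) {ε : ℝ} (hε : 0 < ε) :
    ∀ᶠ H : ℕ in atTop,
      ∫ x, ((1 / (H : ℝ)) * ∑ n ∈ Finset.range H, F (S^[n] x)) ^ 2 ∂ν
        ≤ (∫ x, F x ∂ν) ^ 2 + ε := by
  refine (eventually_integral_sq_ergodicAverage_le hS.toMeasurePreserving hF hε).mono
    fun H hH => hH.trans_eq ?_
  congr 1
  set E := ν[F | MeasurableSpace.invariants S] with hE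
  have hm := (stronglyMeasurable_condExp (f := F) (μ := ν)
    (m := MeasurableSpace.invariants S)).measurable
  have hinv : E ∘ S = E := MeasurableSpace.comp_eq_of_measurable_invariants hm
  obtain ⟨c, hc⟩ := hS.ae_eq_const_of_ae_eq_comp_ae
    (stronglyMeasurable_condExp.mono (MeasurableSpace.invariants_le S)).aestronglyMeasurable
    (Eventually.of_forall fun x => congrFun hinv x)
  have h1 : ∫ x, F x ∂ν = c := by
    rw [← integral_condExp (MeasurableSpace.invariants_le S), integral_congr_ae hc]
    simp
  have h2 : (fun x => E x ^ 2) =ᵐ[ν] fun _ => c ^ 2 := by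
    filter_upwards [hc] with x hx
    rw [hE, hx]
    rfl
  rw [h1, integral_congr_ae h2]
  simp

/-! ### Changing the directions of box averages -/

section Directions

variable {Γ X : Type*} [AddCommGroup Γ] [MeasurableSpace X] {μ : Measure X}
  [IsProbabilityMeasure μ] {φ : Γ → X → X}

/-- In an ergodic direction the innermost average is eventually at most `(∫ F)² + δ`, and `(∫ F)²`
is a lower bound for the innermost average in every direction and at every length. The outer
averages involve finitely many `F`, so one side length serves all of them. -/
lemma eventually_boxAvg_append_le (h : IsErgodicAction μ φ) (x : Γ × ℕ) {c' : Γ} (hc' : c' ≠ 0)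
    (L : List (Γ × ℕ)) : ∀ f, UnitBdd f → ∀ δ > 0, ∀ᶠ j in atTop,
      boxAvg μ φ (L ++ [(c', j)]) f ≤ boxAvg μ φ (L ++ [x]) f + δ := by
  induction L with
  | nil =>
    intro f hf δ hδ
    have h1 := eventually_integral_sq_ergodicAverage_le_of_ergodic (h.ergodic c' hc') hf hδ
    have h2 := (tendsto_pow_atTop_atTop_of_one_lt (one_lt_two (α := ℕ))).eventually h1
    filter_upwards [h2] with j hj
    simp only [List.nil_append]
    rw [boxAvg_singleton h hf]
    simp only [h.nsmul_apply]
    refine hj.trans ?_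
    gcongr
    exact sq_boxAvg_le h x [] f hf
  | cons y L ih =>
    obtain ⟨a, i⟩ := y
    intro f hf δ hδ
    have := (eventually_all_finset (Finset.range (2 ^ i) ×ˢ Finset.range (2 ^ i))).2
      fun q _ => ih _ (hf.boxFactor h (q.1 • a) (q.2 • a)) δ hδ
    filter_upwards [this] with j hj
    simp only [List.cons_append, boxAvg]
    refine (mul_le_mul_of_nonneg_left (Finset.sum_le_sum hj) (by positivity)).trans ?_
    rw [Finset.sum_add_distrib, mul_add]
    gcongr
    simp only [Finset.sum_const, Finset.card_product, Finset.card_range, nsmul_eq_mul]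
    rw [← mul_assoc, one_div, inv_mul_cancel₀ (by positivity), one_mul]

/-- Directions are exchanged one at a time: `M` holds those already replaced, `L` those still to be
replaced. Each exchange spends half of the remaining gap below `ε`. -/
lemma exists_boxAvg_lt_of_directions (h : IsErgodicAction μ φ) {f : X → ℝ} (hf : UnitBdd f)
    {ε : ℝ} : ∀ (cs cs' : List Γ), cs.length = cs'.length → (∀ c ∈ cs', c ≠ 0) →
      ∀ M L : List (Γ × ℕ), L.map Prod.fst = cs → boxAvg μ φ (M ++ L) f < ε →
      ∃ L' : List (Γ × ℕ), L'.map Prod.fst = cs' ∧ boxAvg μ φ (M ++ L') f < ε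
  | [], [], _, _, M, L, hL, hlt => ⟨L, hL, hlt⟩
  | [], _ :: _, hl, _, _, _, _, _ => by simp at hl
  | _ :: _, [], hl, _, _, _, _, _ => by simp at hl
  | c :: cs, c' :: cs', hl, h0, M, L, hL, hlt => by
    obtain ⟨x, L0, rfl, rfl, rfl⟩ := List.map_eq_cons_iff.1 hL
    have p1 : (M ++ x :: L0).Perm ((M ++ L0) ++ [x]) :=
      List.perm_middle.trans (List.perm_append_singleton _ _).symm
    rw [boxAvg_perm h p1] at hlt
    obtain ⟨j, hj⟩ := (eventually_boxAvg_append_le h x (h0 c' (by simp)) (M ++ L0) f hf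
      _ (half_pos (sub_pos.2 hlt))).exists
    have p2 : ((M ++ L0) ++ [(c', j)]).Perm ((M ++ [(c', j)]) ++ L0) := by
      simp only [List.append_assoc]
      exact List.perm_append_comm.append_left M
    rw [boxAvg_perm h p2] at hj
    have hj' : boxAvg μ φ (M ++ [(c', j)] ++ L0) f < ε := by linarith
    obtain ⟨L', hL', hlt'⟩ := exists_boxAvg_lt_of_directions h hf (L0.map Prod.fst) cs'
      (by simpa using hl) (fun a ha => h0 a (by simp [ha])) (M ++ [(c', j)]) L0 rfl
      hj'
    exact ⟨(c', j) :: L', by simp [hL'], by simpa using hlt'⟩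

lemma isBoxNull_of_forall_replicate (h : IsErgodicAction μ φ) {f : X → ℝ} (hf : UnitBdd f)
    {k : ℕ} {c : Γ}
    (H : ∀ ε > 0, ∃ L : List (Γ × ℕ), L.map Prod.fst = List.replicate k c ∧ boxAvg μ φ L f < ε) :
    IsBoxNull μ φ k f := by
  intro cs hcs h0 ε hε
  obtain ⟨L, hL, hlt⟩ := H ε hε
  exact exists_boxAvg_lt_of_directions h hf _ cs (by simp [hcs]) h0 [] L hL hlt

lemma IsBoxNull.anti (h : IsErgodicAction μ φ) {f : X → ℝ} (hf : UnitBdd f) {c : Γ} (hc : c ≠ 0)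
    {k k' : ℕ} (hk : k ≤ k') (hn : IsBoxNull μ φ k' f) : IsBoxNull μ φ k f := by
  induction hk with
  | refl => exact hn
  | step _ ih =>
    -- The nonzero element `c` serves as the additional direction, and `sq_boxAvg_le` discards it at
    -- the price of a square root.
    refine ih fun cs hcs h0 ε hε => ?_
    obtain ⟨L, hL, hlt⟩ := hn (c :: cs) (by simp [hcs])
      (by simpa using ⟨hc, h0⟩) (ε ^ 2) (by positivity)
    obtain ⟨x, L, rfl, -, rfl⟩ := List.map_eq_cons_iff.1 hL
    exact ⟨L, rfl, lt_of_pow_lt_pow_left₀ 2 hε.le ((sq_boxAvg_le h x L f hf).trans_lt hlt)⟩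

end Directions

/-! ### Host-Kra measures -/

lemma condExp_comp_invariants {Y : Type*} [MeasurableSpace Y] {ν : Measure Y} [IsFiniteMeasure ν]
    {S : Y → Y} (hS : MeasurePreserving S ν ν) {F : Y → ℝ} (hF : Integrable F ν) :
    ν[fun y => F (S y) | MeasurableSpace.invariants S]
      =ᵐ[ν] ν[F | MeasurableSpace.invariants S] := by
  have hle := MeasurableSpace.invariants_le S
  refine (ae_eq_condExp_of_forall_setIntegral_eq hle (hS.integrable_comp_of_integrable hF)
    (fun s _ _ => integrable_condExp.integrableOn) ?_
    stronglyMeasurable_condExp.aestronglyMeasurable).symm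
  intro s hs _
  rw [setIntegral_condExp hle hF hs]
  conv_lhs => rw [← hS.map_eq]
  rw [setIntegral_map hs.1 (by rw [hS.map_eq]; exact hF.aestronglyMeasurable)
    hS.measurable.aemeasurable, hs.2]
  rfl

/-- Rectangles determine the measure, and on them it is the integral of a product of two conditional
expectations on the invariant sets, neither of which changes when its set is replaced by its
preimage under `S`. -/
lemma measurePreserving_relIndepSquare {Y : Type*} [MeasurableSpace Y] [StandardBorelSpace Y]
    {ν : ProbabilityMeasure Y} {S : Y → Y} (hS : MeasurePreserving S (ν : Measure Y) ν) :
    MeasurePreserving (Prod.map S S)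
      (relIndepSquare (MeasurableSpace.invariants S) ν (MeasurableSpace.invariants_le S) :
        Measure (Y × Y))
      (relIndepSquare (MeasurableSpace.invariants S) ν (MeasurableSpace.invariants_le S)) := by
  have hm : Measurable (Prod.map S S) := hS.measurable.prodMap hS.measurable
  refine ⟨hm, ?_⟩
  set ρ := relIndepSquare (MeasurableSpace.invariants S) ν (MeasurableSpace.invariants_le S)
  have key : ∀ s t : Set Y, MeasurableSet s → MeasurableSet t →
      (ρ : Measure (Y × Y)).real (s ×ˢ t) = ∫ y,
        ((ν : Measure Y)[s.indicator 1 | MeasurableSpace.invariants S]) y *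
        ((ν : Measure Y)[t.indicator 1 | MeasurableSpace.invariants S]) y ∂(ν : Measure Y) := by
    intro s t hs ht
    have hi : ∀ s : Set Y, MeasurableSet s → MemLp (s.indicator (1 : Y → ℝ)) ∞ (ν : Measure Y) :=
      fun s hs => memLp_indicator_const ∞ hs 1 (Or.inr (measure_ne_top _ _))
    rw [← integral_relIndepSquare _ ν (MeasurableSpace.invariants_le S) (hi s hs) (hi t ht),
      ← integral_indicator_one (hs.prod ht)]
    congr 1
    ext x
    simp only [Set.indicator, Set.mem_prod, Pi.one_apply]
    by_cases h1 : x.1 ∈ s <;> by_cases h2 : x.2 ∈ t <;> simp [h1, h2]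
  have : IsProbabilityMeasure ((ρ : Measure (Y × Y)).map (Prod.map S S)) :=
    Measure.isProbabilityMeasure_map hm.aemeasurable
  refine Measure.ext_prod fun {s t} hs ht => ?_
  rw [Measure.map_apply hm (hs.prod ht), ← measureReal_eq_measureReal_iff]
  have e : Prod.map S S ⁻¹' s ×ˢ t = (S ⁻¹' s) ×ˢ (S ⁻¹' t) := rfl
  rw [e, key _ _ (hS.measurable hs) (hS.measurable ht), key _ _ hs ht]
  have hc : ∀ s : Set Y, MeasurableSet s →
      (ν : Measure Y)[(S ⁻¹' s).indicator (1 : Y → ℝ) | MeasurableSpace.invariants S]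
        =ᵐ[(ν : Measure Y)] (ν : Measure Y)[s.indicator (1 : Y → ℝ) |
          MeasurableSpace.invariants S] := fun s hs =>
    condExp_comp_invariants hS (F := s.indicator 1)
      ((integrable_const (1 : ℝ)).indicator hs)
  refine integral_congr_ae ?_
  filter_upwards [hc s hs, hc t ht] with y h1 h2
  rw [h1, h2]

lemma cubeProd_mul {X : Type*} (f g : X → ℝ) (k : ℕ) (x : Cube X k) :
    cubeProd (fun y => f y * g y) k x = cubeProd f k x * cubeProd g k x := by
  induction k with
  | zero => rfl
  | succ k ih =>
    simp only [cubeProd, ih]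
    ring

lemma cubeProd_cubeMap {X : Type*} (S : X → X) (f : X → ℝ) (k : ℕ) (x : Cube X k) :
    cubeProd f k (cubeMap S k x) = cubeProd (fun y => f (S y)) k x := by
  induction k with
  | zero => rfl
  | succ k ih => exact congrArg₂ (· * ·) (ih x.1) (ih x.2)

lemma cubeProd_cubeMap_iterate {X : Type*} (S : X → X) (f : X → ℝ) (k n : ℕ) (x : Cube X k) :
    cubeProd f k ((cubeMap S k)^[n] x) = cubeProd (fun y => f (S^[n] y)) k x := by
  induction n generalizing f with
  | zero => rfl
  | succ n ih =>
    rw [Function.iterate_succ_apply', cubeProd_cubeMap, ih]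
    simp only [Function.iterate_succ_apply']

section HostKra

variable {X : Type*} [MeasurableSpace X]

lemma UnitBdd.cubeProd {f : X → ℝ} (hf : UnitBdd f) (k : ℕ) : UnitBdd (cubeProd f k) := by
  induction k with
  | zero => exact hf
  | succ k ih => exact (ih.comp measurable_fst).mul (ih.comp measurable_snd)

variable [StandardBorelSpace X] {μ : ProbabilityMeasure X}

lemma measurePreserving_cubeMap {S : X → X} (hS : MeasurePreserving S (μ : Measure X) μ) (k : ℕ) :
    MeasurePreserving (cubeMap S k) (hostKraMeasure μ S k : Measure (Cube X k))
      (hostKraMeasure μ S k) := by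
  induction k with
  | zero => exact hS
  | succ k ih => exact measurePreserving_relIndepSquare ih

lemma integral_cubeProd_succ (S : X → X) {f : X → ℝ} (hf : UnitBdd f) (k : ℕ) :
    ∫ x, cubeProd f (k + 1) x ∂(hostKraMeasure μ S (k + 1) : Measure (Cube X (k + 1))) =
      ∫ x, ((hostKraMeasure μ S k : Measure (Cube X k))[cubeProd f k |
        MeasurableSpace.invariants (cubeMap S k)]) x ^ 2
        ∂(hostKraMeasure μ S k : Measure (Cube X k)) := by
  have h := (hf.cubeProd k).memLp (hostKraMeasure μ S k : Measure (Cube X k)) ∞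
  simp only [pow_two]
  exact integral_relIndepSquare _ (hostKraMeasure μ S k) (MeasurableSpace.invariants_le _) h h

/-- The integral of order `k + 1` is the squared norm of a conditional expectation, which an ergodic
average of some length `2 ^ i` matches from above up to `ε / 2`. Expanding its square gives
integrals of order `k` of the functions `f ∘ φ (q.1 • c) * f ∘ φ (q.2 • c)`, to which induction
applies. -/
lemma eventually_boxAvg_le_integral_cubeProd {Γ : Type*} [AddCommGroup Γ] {φ : Γ → X → X}
    (h : IsErgodicAction (μ : Measure X) φ) (c : Γ) (k : ℕ) :
    ∀ f, UnitBdd f → ∀ ε > 0, ∀ᶠ j in atTop,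
      boxAvg (μ : Measure X) φ (List.replicate k (c, j)) f ≤
        ∫ x, cubeProd f k x ∂(hostKraMeasure μ (φ c) k : Measure (Cube X k)) + ε := by
  induction k with
  | zero =>
    intro f _ ε hε
    refine Eventually.of_forall fun j => ?_
    exact (le_add_of_nonneg_right hε.le)
  | succ k ih =>
    intro f hf ε hε
    have h1 := eventually_integral_sq_ergodicAverage_le
      (measurePreserving_cubeMap (h.measurePreserving c) k) (hf.cubeProd k) (half_pos hε)
    obtain ⟨i, hi⟩ :=
      ((tendsto_pow_atTop_atTop_of_one_lt (one_lt_two (α := ℕ))).eventually h1).exists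
    rw [← integral_cubeProd_succ _ hf] at hi
    set Q := Finset.range (2 ^ i) ×ˢ Finset.range (2 ^ i) with hQ
    have e : ∫ x, ((1 / ((2 ^ i : ℕ) : ℝ)) * ∑ n ∈ Finset.range (2 ^ i),
          cubeProd f k ((cubeMap (φ c) k)^[n] x)) ^ 2
          ∂(hostKraMeasure μ (φ c) k : Measure (Cube X k))
        = (1 / ((2 ^ i * 2 ^ i : ℕ) : ℝ)) * ∑ q ∈ Q,
          ∫ x, cubeProd (fun x => f (φ (q.1 • c) x) * f (φ (q.2 • c) x)) k x
            ∂(hostKraMeasure μ (φ c) k : Measure (Cube X k)) := by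
      rw [← integral_finsetSum _ fun q _ =>
        ((hf.boxFactor h (q.1 • c) (q.2 • c)).cubeProd k).integrable _, ← integral_const_mul]
      congr 1
      ext x
      rw [mul_pow, pow_two (Finset.sum _ _), Finset.sum_mul_sum, hQ, Finset.sum_product]
      simp only [cubeProd_mul, cubeProd_cubeMap_iterate, h.nsmul_apply]
      push_cast
      ring
    rw [e] at hi
    have h2 := (eventually_all_finset Q).2
      fun q _ => ih _ (hf.boxFactor h (q.1 • c) (q.2 • c)) _ (half_pos hε)
    filter_upwards [h2, eventually_ge_atTop i] with j hj hij
    -- The length `i` is fixed before `j`; monotonicity in the sides then lets the outer side share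
    -- the common value `j ≥ i`.
    calc boxAvg (μ : Measure X) φ (List.replicate (k + 1) (c, j)) f
        ≤ boxAvg (μ : Measure X) φ ((c, i) :: List.replicate k (c, j)) f :=
          boxAvg_anti h (L := (c, i) :: List.replicate k (c, j))
            (L' := (c, j) :: List.replicate k (c, j))
            (List.Forall₂.cons ⟨rfl, hij⟩ (List.forall₂_same.2 fun _ _ => ⟨rfl, le_rfl⟩)) f hf
      _ ≤ _ := (mul_le_mul_of_nonneg_left (Finset.sum_le_sum hj) (by positivity))
      _ ≤ _ := by
        rw [Finset.sum_add_distrib, mul_add]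
        have : (1 / ((2 ^ i * 2 ^ i : ℕ) : ℝ)) * ∑ q ∈ Q, ε / 2 = ε / 2 := by
          rw [hQ]
          simp only [Finset.sum_const, Finset.card_product, Finset.card_range, nsmul_eq_mul]
          rw [← mul_assoc, one_div, inv_mul_cancel₀ (by positivity), one_mul]
        linarith

/-- A function whose Host-Kra integral vanishes is null. -/
theorem isBoxNull_of_integral_cubeProd_eq_zero {Γ : Type*} [AddCommGroup Γ] {φ : Γ → X → X}
    (h : IsErgodicAction (μ : Measure X) φ) {c : Γ} {k : ℕ} {f : X → ℝ} (hf : UnitBdd f)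
    (h0 : ∫ x, cubeProd f k x ∂(hostKraMeasure μ (φ c) k : Measure (Cube X k)) = 0) :
    IsBoxNull (μ : Measure X) φ k f := by
  refine isBoxNull_of_forall_replicate h hf (c := c) fun ε hε => ?_
  obtain ⟨j, hj⟩ := (eventually_boxAvg_le_integral_cubeProd h c k f hf _ (half_pos hε)).exists
  exact ⟨List.replicate k (c, j), by simp, by linarith⟩

end HostKra

/-! ### Upper bounds for upper limits -/

/-- The upper limit of `a` is at most `b`. -/
def LimsupLE (a : ℕ → ℝ) (b : ℝ) : Prop := ∀ ε > 0, ∀ᶠ N in atTop, a N ≤ b + ε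

namespace LimsupLE

variable {a a' : ℕ → ℝ} {b : ℝ}

lemma mono (h : LimsupLE a b) (h' : ∀ᶠ N in atTop, a' N ≤ a N) : LimsupLE a' b := fun ε hε => by
  filter_upwards [h ε hε, h'] with N h1 h2 using h2.trans h1

lemma add_of_tendsto (h : LimsupLE a b) {δ : ℕ → ℝ} (hδ : Tendsto δ atTop (𝓝 0)) :
    LimsupLE (fun N => a N + δ N) b := fun ε hε => by
  filter_upwards [h _ (half_pos hε), hδ.eventually_le_const (half_pos hε)] with N h1 h2
  linarith

lemma average {ι : Type*} (Q : Finset ι) {a : ι → ℕ → ℝ} {b : ι → ℝ}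
    (h : ∀ q ∈ Q, LimsupLE (a q) (b q)) :
    LimsupLE (fun N => (1 / (Q.card : ℝ)) * ∑ q ∈ Q, a q N)
      ((1 / (Q.card : ℝ)) * ∑ q ∈ Q, b q) := fun ε hε => by
  filter_upwards [(eventually_all_finset Q).2 fun q hq => h q hq ε hε] with N hN
  refine (mul_le_mul_of_nonneg_left (Finset.sum_le_sum hN) (by positivity)).trans ?_
  rw [Finset.sum_add_distrib, mul_add]
  gcongr
  simp only [Finset.sum_const, nsmul_eq_mul]
  rw [← mul_assoc, one_div]
  exact mul_le_of_le_one_left hε.le inv_mul_le_one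

lemma of_tendsto (h : Tendsto a atTop (𝓝 b)) : LimsupLE a b := fun ε hε =>
  h.eventually_le_const (by linarith)

lemma tendsto_zero (h : LimsupLE a 0) (h0 : ∀ N, 0 ≤ a N) : Tendsto a atTop (𝓝 0) := by
  rw [Metric.tendsto_atTop']
  intro ε hε
  obtain ⟨N, hN⟩ := eventually_atTop.1 (h _ (half_pos hε))
  refine ⟨N, fun n hn => ?_⟩
  rw [Real.dist_eq, sub_zero, abs_of_nonneg (h0 n)]
  linarith [hN n hn.le]

end LimsupLE

/-! ### Følner sequences and the van der Corput inequality -/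

lemma abs_average_integral_le {ι X : Type*} [MeasurableSpace X] {μ : Measure X}
    [IsProbabilityMeasure μ] (Φ : Finset ι) {R : ι → X → ℝ} (hR : ∀ u, UnitBdd (R u)) :
    |(1 / (Φ.card : ℝ)) * ∑ u ∈ Φ, ∫ x, R u x ∂μ| ≤ 1 := by
  obtain ⟨x⟩ : Nonempty X := nonempty_of_isProbabilityMeasure μ
  exact (UnitBdd.average (X := X) Φ fun u _ => UnitBdd.const ((hR u).abs_integral_le μ)).abs_le x

/-- The Cauchy-Schwarz inequality for averages of correlations. -/
lemma sq_average_integral_mul_le {ι X : Type*} [MeasurableSpace X]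
    {μ : Measure X} [IsProbabilityMeasure μ] (Φ : Finset ι) {g : X → ℝ}
    (hg : UnitBdd g) {R : ι → X → ℝ}
    (hR : ∀ u, UnitBdd (R u)) :
    ((1 / (Φ.card : ℝ)) * ∑ u ∈ Φ, ∫ x, g x * R u x ∂μ) ^ 2 ≤
      ∫ x, ((1 / (Φ.card : ℝ)) * ∑ u ∈ Φ, R u x) ^ 2 ∂μ := by
  have hW := UnitBdd.average Φ fun u _ => hR u
  have e : (1 / (Φ.card : ℝ)) * ∑ u ∈ Φ, ∫ x, g x * R u x ∂μ
      = ∫ x, g x * ((1 / (Φ.card : ℝ)) * ∑ u ∈ Φ, R u x) ∂μ := by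
    rw [← integral_finsetSum _ fun u _ => (hg.mul (hR u)).integrable μ, ← integral_const_mul]
    congr 1
    ext x
    rw [← Finset.mul_sum]
    ring
  rw [e]
  refine ((hg.mul hW).sq_integral_le μ).trans
    (integral_mono ((hg.mul hW).sq.integrable μ) (hW.sq.integrable μ) fun x => ?_)
  change (g x * _) ^ 2 ≤ _
  rw [mul_pow]
  refine mul_le_of_le_one_left (sq_nonneg _) ?_
  exact (sq_le_one_iff_abs_le_one _).2 (hg.abs_le x)

section Folner

variable {G : Type*} [AddCommGroup G]

open Classical in
/-- The proportion of `Φ` which is moved by the translation by `g`. -/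
noncomputable def translationDefect (Φ : Finset G) (g : G) : ℝ :=
  (symmDiff (Φ.map (addLeftEmbedding g)) Φ).card / (Φ.card : ℝ)

lemma translationDefect_nonneg (Φ : Finset G) (g : G) : 0 ≤ translationDefect Φ g := by
  unfold translationDefect
  positivity

/-- Følner sequences, in terms of cardinalities. -/
structure IsFolnerSequence (Φ : ℕ → Finset G) : Prop where
  nonempty : ∀ᶠ N in atTop, (Φ N).Nonempty
  tendsto_defect : ∀ g, Tendsto (fun N => translationDefect (Φ N) g) atTop (𝓝 0)

lemma abs_average_translate_sub_le (Φ : Finset G) (g : G) {a : G → ℝ} (ha : ∀ u, |a u| ≤ 1) :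
    |(1 / (Φ.card : ℝ)) * ∑ u ∈ Φ, a u - (1 / (Φ.card : ℝ)) * ∑ u ∈ Φ, a (u + g)|
      ≤ translationDefect Φ g := by
  classical
  have e : ∑ u ∈ Φ, a (u + g) = ∑ u ∈ Φ.map (addLeftEmbedding g), a u := by
    simp [add_comm]
  have hb : ∀ s : Finset G, |∑ u ∈ s, a u| ≤ s.card := fun s =>
    (Finset.abs_sum_le_sum_abs _ _).trans
      (by simpa using Finset.sum_le_sum fun u (_ : u ∈ s) => ha u)
  rw [← mul_sub, e, abs_mul, abs_of_nonneg (by positivity : (0 : ℝ) ≤ 1 / (Φ.card : ℝ)),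
    ← Finset.sum_sdiff_sub_sum_sdiff, translationDefect, one_div,
    div_eq_inv_mul]
  gcongr
  refine (abs_sub _ _).trans ?_
  refine (add_le_add (hb _) (hb _)).trans ?_
  rw [← Nat.cast_add, symmDiff_def, Finset.sup_eq_union,
    Finset.card_union_of_disjoint disjoint_sdiff_sdiff, add_comm]

variable {X : Type*} [MeasurableSpace X] {μ : Measure X} [IsProbabilityMeasure μ]

/-- The van der Corput inequality. -/
theorem integral_sq_average_le (Φ : Finset G) {A : G → X → ℝ} (hA : ∀ u, UnitBdd (A u)) (v : G)
    {H : ℕ} (hH : H ≠ 0) :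
    ∫ x, ((1 / (Φ.card : ℝ)) * ∑ u ∈ Φ, A u x) ^ 2 ∂μ ≤
      (1 / ((Finset.range H ×ˢ Finset.range H).card : ℝ)) *
        ∑ q ∈ Finset.range H ×ˢ Finset.range H,
          (1 / (Φ.card : ℝ)) * ∑ u ∈ Φ, ∫ x, A (u + q.1 • v) x * A (u + q.2 • v) x ∂μ
      + 2 * ∑ n ∈ Finset.range H, translationDefect Φ (n • v) := by
  set Q := Finset.range H ×ˢ Finset.range H with hQ
  have hHpos : (0 : ℝ) < H := by positivity
  have hQc : (Q.card : ℝ) = H * H := by simp [hQ]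
  set D := ∑ n ∈ Finset.range H, translationDefect Φ (n • v) with hD
  have hAA : ∀ (q : ℕ × ℕ) (u : G), UnitBdd fun x => A (u + q.1 • v) x * A (u + q.2 • v) x :=
    fun q u => (hA _).mul (hA _)
  have key : ∀ x, ((1 / (Φ.card : ℝ)) * ∑ u ∈ Φ, A u x) ^ 2 ≤
      (1 / (Q.card : ℝ)) * ∑ q ∈ Q,
        (1 / (Φ.card : ℝ)) * ∑ u ∈ Φ, (A (u + q.1 • v) x * A (u + q.2 • v) x) + 2 * D := by
    intro x
    set a := (1 / (Φ.card : ℝ)) * ∑ u ∈ Φ, A u x with ha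
    set B : G → ℝ := fun u => (1 / (H : ℝ)) * ∑ n ∈ Finset.range H, A (u + n • v) x with hB
    set b := (1 / (Φ.card : ℝ)) * ∑ u ∈ Φ, B u with hb
    have ha1 : |a| ≤ 1 := (UnitBdd.average Φ fun u _ => hA u).abs_le x
    have hB1 : ∀ u, |B u| ≤ 1 := fun u => by
      simpa [hB] using (UnitBdd.average (Finset.range H) fun n _ => hA (u + n • v)).abs_le x
    have hb1 : |b| ≤ 1 :=
      (UnitBdd.average (X := X) Φ fun u _ => UnitBdd.const (hB1 u)).abs_le x
    -- Averaging the translation errors over `n` carries a factor `1 / H`, which is bounded crudely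
    -- by `1`: for fixed `H` and `v` the sum `D` already tends to zero along a Følner sequence.
    have hab : |a - b| ≤ D := by
      have e : a - b = ∑ n ∈ Finset.range H, (1 / (H : ℝ)) *
          (a - (1 / (Φ.card : ℝ)) * ∑ u ∈ Φ, A (u + n • v) x) := by
        have hb' : b = (1 / (H : ℝ)) * ∑ n ∈ Finset.range H,
            (1 / (Φ.card : ℝ)) * ∑ u ∈ Φ, A (u + n • v) x := by
          simp only [hb, hB, Finset.mul_sum]
          rw [Finset.sum_comm]
          exact Finset.sum_congr rfl fun _ _ => Finset.sum_congr rfl fun _ _ => by ring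
        rw [← Finset.mul_sum, Finset.sum_sub_distrib, hb', Finset.sum_const, Finset.card_range,
          nsmul_eq_mul, mul_sub, ← mul_assoc, one_div, inv_mul_cancel₀ hHpos.ne', one_mul]
      rw [e]
      refine (Finset.abs_sum_le_sum_abs _ _).trans (Finset.sum_le_sum fun n _ => ?_)
      rw [abs_mul, abs_of_nonneg (by positivity)]
      refine (mul_le_of_le_one_left (abs_nonneg _) ?_).trans
        (abs_average_translate_sub_le Φ (n • v) fun u => (hA u).abs_le x)
      rw [div_le_one hHpos]
      exact_mod_cast Nat.one_le_iff_ne_zero.2 hH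
    have h1 : a ^ 2 ≤ b ^ 2 + 2 * D := by
      have : (a - b) * (a + b) ≤ D * 2 := by
        refine (le_abs_self _).trans ?_
        rw [abs_mul]
        exact mul_le_mul hab ((abs_add_le _ _).trans (by linarith)) (abs_nonneg _)
          ((abs_nonneg _).trans hab)
      nlinarith
    have h2 : b ^ 2 ≤ (1 / (Φ.card : ℝ)) * ∑ u ∈ Φ, B u ^ 2 := sq_average_le Φ B
    have h3 : (1 / (Φ.card : ℝ)) * ∑ u ∈ Φ, B u ^ 2 = (1 / (Q.card : ℝ)) * ∑ q ∈ Q,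
        (1 / (Φ.card : ℝ)) * ∑ u ∈ Φ, (A (u + q.1 • v) x * A (u + q.2 • v) x) := by
      have hBu : ∀ u, B u ^ 2 = (1 / (Q.card : ℝ)) * ∑ q ∈ Q,
          (A (u + q.1 • v) x * A (u + q.2 • v) x) := fun u => by
        rw [hQc, mul_pow, pow_two (Finset.sum _ _), Finset.sum_mul_sum, hQ, Finset.sum_product]
        congr 1
        field_simp
      simp only [hBu, Finset.mul_sum]
      rw [Finset.sum_comm]
      exact Finset.sum_congr rfl fun _ _ => Finset.sum_congr rfl fun _ _ => by ring
    linarith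
  have hav : ∀ q : ℕ × ℕ, UnitBdd fun x =>
      (1 / (Φ.card : ℝ)) * ∑ u ∈ Φ, (A (u + q.1 • v) x * A (u + q.2 • v) x) :=
    fun q => UnitBdd.average Φ fun u _ => hAA q u
  have hav2 := UnitBdd.average Q fun q _ => hav q
  refine (integral_mono ((UnitBdd.average Φ fun u _ => hA u).sq.integrable μ)
    ((hav2.integrable μ).add (integrable_const _)) key).trans_eq ?_
  rw [integral_add' (hav2.integrable μ) (integrable_const _), integral_const_mul,
    integral_finsetSum _ fun q _ => (hav q).integrable μ]
  simp only [integral_const, probReal_univ, one_smul]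
  congr 2
  refine Finset.sum_congr rfl fun q _ => ?_
  rw [integral_const_mul, integral_finsetSum _ fun u _ => (hAA q u).integrable μ]

end Folner

/-! ### Averages along linear families -/

/-- Raises the van der Corput inequality to a power while its error term stays linear in `δ`. -/
lemma pow_le_pow_add_mul {a z δ : ℝ} (ha : 0 ≤ a) (ha1 : a ≤ 1) (hz : 0 ≤ z) (hz1 : z ≤ 1)
    (h : a ≤ z + δ) (hδ : 0 ≤ δ) (m : ℕ) : a ^ m ≤ z ^ m + m * δ := by
  induction m with
  | zero => simp
  | succ m ih =>
    have h1 : z ^ m ≤ 1 := pow_le_one₀ hz hz1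
    have h2 : 0 ≤ z ^ m := pow_nonneg hz m
    calc a ^ (m + 1) = a * a ^ m := pow_succ' a m
      _ ≤ a * (z ^ m + m * δ) := by gcongr
      _ = a * z ^ m + a * (m * δ) := by ring
      _ ≤ (z + δ) * z ^ m + 1 * (m * δ) := by gcongr
      _ = z ^ (m + 1) + z ^ m * δ + m * δ := by ring
      _ ≤ z ^ (m + 1) + 1 * δ + m * δ := by gcongr
      _ = _ := by push_cast; ring

lemma average_pow_le {ι : Type*} (Q : Finset ι) (x : ι → ℝ) {n : ℕ} (hn : Even n) (hn0 : n ≠ 0) :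
    ((1 / (Q.card : ℝ)) * ∑ q ∈ Q, x q) ^ n ≤ (1 / (Q.card : ℝ)) * ∑ q ∈ Q, x q ^ n := by
  rcases Q.eq_empty_or_nonempty with rfl | hQ
  · simp [hn0]
  have hc : (Q.card : ℝ) ≠ 0 := by exact_mod_cast hQ.card_pos.ne'
  simp only [Finset.mul_sum]
  exact Real.pow_arith_mean_le_arith_mean_pow_of_even Q (fun _ => 1 / (Q.card : ℝ)) x
    (fun _ _ => by positivity) (by simp [hc]) hn

section Linear

variable {Γ G X ι : Type*} [MeasurableSpace X] {μ : Measure X} {φ : Γ → X → X}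

/-- The square of the norm of the average of `∏ i ∈ t, f i ∘ φ (p i u)`. -/
noncomputable def sqNormAverage (μ : Measure X) (φ : Γ → X → X) (t : Finset ι) (p : ι → G → Γ)
    (f : ι → X → ℝ) (Φ : Finset G) : ℝ :=
  ∫ x, ((1 / (Φ.card : ℝ)) * ∑ u ∈ Φ, ∏ i ∈ t, f i (φ (p i u) x)) ^ 2 ∂μ

lemma sqNormAverage_nonneg (t : Finset ι) (p : ι → G → Γ) (f : ι → X → ℝ) (Φ : Finset G) :
    0 ≤ sqNormAverage μ φ t p f Φ := integral_nonneg fun _ => sq_nonneg _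

variable [AddCommGroup Γ]

lemma IsErgodicAction.integral_prod_shift (h : IsErgodicAction μ φ) (t : Finset ι) {f : ι → X → ℝ}
    (hf : ∀ i, UnitBdd (f i)) (p : ι → Γ) (c : Γ) :
    ∫ x, ∏ i ∈ t, f i (φ (p i) x) ∂μ = ∫ x, ∏ i ∈ t, f i (φ (p i - c) x) ∂μ := by
  rw [← h.integral_comp (-c)
    (UnitBdd.prod t fun i _ => (hf i).comp (h.measurable (p i))).measurable]
  simp only [← h.add_apply, sub_eq_add_neg]

lemma UnitBdd.prodShift (h : IsErgodicAction μ φ) {f : ι → X → ℝ}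
    (hf : ∀ i, UnitBdd (f i)) (t : Finset ι) (p : ι → Γ) :
    UnitBdd fun x => ∏ i ∈ t, f i (φ (p i) x) :=
  UnitBdd.prod t fun i _ => (hf i).comp (h.measurable _)

/-- Linearity turns a shift of `u` into a fixed translate of each function. A van der Corput step
thus keeps the family and replaces each `f i` by exactly the factor that occurs in a box average
with direction `L i v`. -/
lemma prod_mul_prod_linear [AddCommGroup G] (h : IsErgodicAction μ φ) (t : Finset ι) (f : ι → X → ℝ)
    (L : ι → G →+ Γ) (b : ι → Γ) (u v : G) (q : ℕ × ℕ) (x : X) :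
    (∏ i ∈ t, f i (φ (L i (u + q.1 • v) + b i) x)) * ∏ i ∈ t, f i (φ (L i (u + q.2 • v) + b i) x)
      = ∏ i ∈ t, (fun y => f i (φ (q.1 • L i v) y) * f i (φ (q.2 • L i v) y))
          (φ (L i u + b i) x) := by
  rw [← Finset.prod_mul_distrib]
  refine Finset.prod_congr rfl fun i _ => ?_
  simp only [← h.add_apply, map_add, map_nsmul]
  congr 3 <;> abel

variable [IsProbabilityMeasure μ]

lemma sqNormAverage_le_one (h : IsErgodicAction μ φ) {f : ι → X → ℝ}
    (hf : ∀ i, UnitBdd (f i)) (t : Finset ι) (p : ι → G → Γ) (Φ : Finset G) :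
    sqNormAverage μ φ t p f Φ ≤ 1 :=
  (le_abs_self _).trans ((UnitBdd.average Φ fun u _ =>
    UnitBdd.prodShift h hf t fun i => p i u).sq.abs_integral_le μ)

/-- Terms whose polynomial is constant may be omitted. -/
lemma sqNormAverage_insert_le [DecidableEq ι] (h : IsErgodicAction μ φ) {f : ι → X → ℝ}
    (hf : ∀ i, UnitBdd (f i)) {t : Finset ι} {m : ι} (hm : m ∉ t) {p : ι → G → Γ} {c : Γ}
    (hc : ∀ u, p m u = c) (Φ : Finset G) :
    sqNormAverage μ φ (insert m t) p f Φ ≤ sqNormAverage μ φ t p f Φ := by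
  have hW : UnitBdd fun x => (1 / (Φ.card : ℝ)) * ∑ u ∈ Φ, ∏ i ∈ t, f i (φ (p i u) x) :=
    UnitBdd.average Φ fun u _ => UnitBdd.prodShift h hf t fun i => p i u
  have hW' : UnitBdd fun x => (1 / (Φ.card : ℝ)) * ∑ u ∈ Φ, ∏ i ∈ insert m t, f i (φ (p i u) x) :=
    UnitBdd.average Φ fun u _ => UnitBdd.prodShift h hf (insert m t) fun i => p i u
  refine integral_mono (hW'.sq.integrable μ) (hW.sq.integrable μ) fun x => ?_
  simp only [Finset.prod_insert hm, hc, ← Finset.mul_sum]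
  rw [mul_left_comm, mul_pow]
  exact mul_le_of_le_one_left (sq_nonneg _) ((sq_le_one_iff_abs_le_one _).2 ((hf m).abs_le _))

variable [AddCommGroup G]

variable {Φ : ℕ → Finset G}

lemma IsFolnerSequence.tendsto_sum_defect (hΦ : IsFolnerSequence Φ) (H : ℕ) (v : G) :
    Tendsto (fun N => 2 * ∑ n ∈ Finset.range H, translationDefect (Φ N) (n • v)) atTop (𝓝 0) := by
  have := (tendsto_finsetSum (Finset.range H) fun n _ => hΦ.tendsto_defect (n • v)).const_mul 2
  simpa using this

/-- Averages along linear families are controlled by box averages of any function of the family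
whose linear part is nonzero and different from the other linear parts. -/
theorem exists_directions_of_linear [DecidableEq ι] (h : IsErgodicAction μ φ)
    (hΦ : IsFolnerSequence Φ) (i₀ : ι) (s : Finset ι) :
    ∀ L : ι → G →+ Γ, L i₀ ≠ 0 → (∀ i ∈ s, L i₀ ≠ L i) →
      ∃ cs : List Γ, cs.length = s.card + 1 ∧ (∀ c ∈ cs, c ≠ 0) ∧
        ∀ (b : ι → Γ) (f : ι → X → ℝ), (∀ i, UnitBdd (f i)) →
          ∀ K : List (Γ × ℕ), K.map Prod.fst = cs →
            LimsupLE (fun N => sqNormAverage μ φ (insert i₀ s) (fun i u => L i u + b i) f (Φ N)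
              ^ (2 ^ s.card)) (boxAvg μ φ K (f i₀)) := by
  induction s using Finset.induction_on with
  | empty =>
    intro L h0 _
    obtain ⟨v, hv⟩ := DFunLike.ne_iff.1 h0
    refine ⟨[L i₀ v], by simp, by simpa using hv, fun b f hf K hK => ?_⟩
    obtain ⟨⟨_, j⟩, K, rfl, rfl, hK'⟩ := List.map_eq_cons_iff.1 hK
    obtain rfl := List.map_eq_nil_iff.1 hK'
    simp only [Finset.card_empty, pow_zero, pow_one]
    have hvdc := fun N => integral_sq_average_le (μ := μ) (Φ N)
      (fun u => UnitBdd.prodShift h hf (insert i₀ ∅) fun i => L i u + b i) v (H := 2 ^ j)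
      (by positivity)
    refine LimsupLE.mono (LimsupLE.add_of_tendsto (a := fun _ => boxAvg μ φ [(L i₀ v, j)] (f i₀))
      (LimsupLE.of_tendsto tendsto_const_nhds) (hΦ.tendsto_sum_defect (2 ^ j) v)) ?_
    filter_upwards [hΦ.nonempty] with N hN
    refine (hvdc N).trans_eq ?_
    have hN' : ((Φ N).card : ℝ) ≠ 0 := by exact_mod_cast hN.card_pos.ne'
    simp only [prod_mul_prod_linear h]
    congr 1
    simp only [boxAvg, Finset.card_product, Finset.card_range]
    congr 1
    refine Finset.sum_congr rfl fun q _ => ?_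
    have e : ∀ u, ∫ x, ∏ i ∈ insert i₀ ∅, (fun y => f i (φ (q.1 • L i v) y) *
        f i (φ (q.2 • L i v) y)) (φ (L i u + b i) x) ∂μ
        = ∫ x, f i₀ (φ (q.1 • L i₀ v) x) * f i₀ (φ (q.2 • L i₀ v) x) ∂μ := fun u => by
      simp only [insert_empty_eq, Finset.prod_singleton]
      exact h.integral_comp _ ((hf i₀).boxFactor h _ _).measurable
    simp only [e, Finset.sum_const, nsmul_eq_mul]
    field_simp
  | insert m s hms ih =>
    intro L h0 hL
    obtain ⟨v, hv⟩ := DFunLike.ne_iff.1 h0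
    -- Subtracting `L m` makes the factor of index `m` independent of `u`, so that Cauchy–Schwarz
    -- removes it. The directions `cs` depend only on the linear parts, so they are common to all
    -- pairs `q` and the bounds assemble into one box average.
    obtain ⟨cs, hcs, hcs0, H⟩ := ih (fun i => L i - L m)
      (sub_ne_zero.2 (hL m (Finset.mem_insert_self m s)))
      (fun i hi e => hL i (Finset.mem_insert_of_mem hi) (sub_left_injective e))
    refine ⟨L i₀ v :: cs, by simp [hcs, Finset.card_insert_of_notMem hms],
      by simpa using ⟨hv, hcs0⟩, fun b f hf K hK => ?_⟩
    obtain ⟨⟨_, j⟩, K, rfl, rfl, hK'⟩ := List.map_eq_cons_iff.1 hK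
    have hm0 : m ≠ i₀ := fun e => hL m (Finset.mem_insert_self m s) (by rw [e])
    have hmt : m ∉ insert i₀ s := by simp [hm0, hms]
    rw [Finset.card_insert_of_notMem hms, Finset.insert_comm]
    set M := 2 ^ s.card with hM
    set Q := Finset.range (2 ^ j) ×ˢ Finset.range (2 ^ j) with hQ
    set g : ℕ × ℕ → ι → X → ℝ :=
      fun q i y => f i (φ (q.1 • L i v) y) * f i (φ (q.2 • L i v) y) with hg
    have hgu : ∀ q i, UnitBdd (g q i) := fun q i => (hf i).boxFactor h _ _
    set x : ℕ × ℕ → ℕ → ℝ := fun q N => (1 / ((Φ N).card : ℝ)) * ∑ u ∈ Φ N,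
      ∫ y, ∏ i ∈ insert m (insert i₀ s), g q i (φ (L i u + b i) y) ∂μ with hx
    set a : ℕ → ℝ := fun N => sqNormAverage μ φ (insert m (insert i₀ s))
      (fun i u => L i u + b i) f (Φ N) with ha
    set D : ℕ → ℝ := fun N => 2 * ∑ n ∈ Finset.range (2 ^ j), translationDefect (Φ N) (n • v)
      with hD
    have hD0 : ∀ N, 0 ≤ D N := fun N =>
      mul_nonneg two_pos.le (Finset.sum_nonneg fun n _ => translationDefect_nonneg _ _)
    have hvdc : ∀ N, a N ≤ (1 / (Q.card : ℝ)) * ∑ q ∈ Q, x q N + D N := fun N => by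
      have := integral_sq_average_le (μ := μ) (Φ N)
        (fun u => UnitBdd.prodShift h hf (insert m (insert i₀ s)) fun i => L i u + b i) v
        (H := 2 ^ j) (by positivity)
      simp only [prod_mul_prod_linear h] at this
      exact this
    have hx1 : ∀ q N, |x q N| ≤ 1 := fun q N =>
      abs_average_integral_le (Φ N) fun u => UnitBdd.prodShift h (hgu q) _ _
    have hxsq : ∀ q N, x q N ^ 2 ≤ sqNormAverage μ φ (insert i₀ s)
        (fun i u => (L i - L m) u + (b i - b m)) (g q) (Φ N) := fun q N => by
      have e : ∀ u, ∫ y, ∏ i ∈ insert m (insert i₀ s), g q i (φ (L i u + b i) y) ∂μ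
          = ∫ y, g q m y * ∏ i ∈ insert i₀ s, g q i (φ ((L i - L m) u + (b i - b m)) y) ∂μ := by
        intro u
        rw [h.integral_prod_shift _ (hgu q) (fun i => L i u + b i) (L m u + b m)]
        simp only [Finset.prod_insert hmt, sub_self, h.zero_apply, AddMonoidHom.sub_apply,
          add_sub_add_comm, add_zero]
      simp only [hx, e]
      exact sq_average_integral_mul_le (Φ N) (hgu q m) fun u => UnitBdd.prodShift h (hgu q) _ _
    clear_value x
    have hxlim : ∀ q ∈ Q, LimsupLE (fun N => |x q N| ^ (2 * M)) (boxAvg μ φ K (g q i₀)) :=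
      -- Cauchy–Schwarz bounds `x q N ^ 2`, so the exponent doubles with each function removed.
      fun q _ => (H (fun i => b i - b m) (g q) (hgu q) K hK').mono (Eventually.of_forall fun N => by
        rw [pow_mul, sq_abs]
        exact pow_le_pow_left₀ (sq_nonneg _) (hxsq q N) M)
    have hlim := (LimsupLE.average Q hxlim).add_of_tendsto
      (δ := fun N => ((2 * M : ℕ) : ℝ) * D N)
      (by simpa using (hΦ.tendsto_sum_defect (2 ^ j) v).const_mul ((2 * M : ℕ) : ℝ))
    have hb : boxAvg μ φ ((L i₀ v, j) :: K) (f i₀)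
        = (1 / (Q.card : ℝ)) * ∑ q ∈ Q, boxAvg μ φ K (g q i₀) := by
      simp [boxAvg, hQ, hg]
    rw [hb]
    refine hlim.mono (Eventually.of_forall fun N => ?_)
    have hz1 : (1 / (Q.card : ℝ)) * ∑ q ∈ Q, |x q N| ≤ 1 := by
      obtain ⟨y⟩ : Nonempty X := nonempty_of_isProbabilityMeasure μ
      exact (le_abs_self _).trans ((UnitBdd.average (X := X) Q fun q _ =>
        UnitBdd.const (a := |x q N|) (by rw [abs_abs]; exact hx1 q N)).abs_le y)
    have hQ0 : 0 ≤ 1 / (Q.card : ℝ) := one_div_nonneg.2 (Nat.cast_nonneg _)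
    have hz : 0 ≤ (1 / (Q.card : ℝ)) * ∑ q ∈ Q, |x q N| :=
      mul_nonneg hQ0 (Finset.sum_nonneg fun _ _ => abs_nonneg _)
    have h2M : 2 ^ (s.card + 1) = 2 * M := by rw [hM, pow_succ, mul_comm]
    rw [h2M]
    refine (pow_le_pow_add_mul (sqNormAverage_nonneg _ _ _ _)
      (sqNormAverage_le_one h hf _ _ _) hz hz1 ((hvdc N).trans ?_) (hD0 N) (2 * M)).trans ?_
    · exact add_le_add_left (mul_le_mul_of_nonneg_left
        (Finset.sum_le_sum fun _ _ => le_abs_self _) hQ0) _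
    · exact add_le_add_left (average_pow_le Q _ (even_two_mul M) (by positivity)) _

/-- Averages along linear families tend to zero if a function whose linear part is nonzero and
different from the other linear parts is null. -/
theorem tendsto_sqNormAverage_linear [DecidableEq ι] (h : IsErgodicAction μ φ)
    (hΦ : IsFolnerSequence Φ) {i₀ : ι} {s : Finset ι} {L : ι → G →+ Γ} (h0 : L i₀ ≠ 0)
    (hL : ∀ i ∈ s, L i₀ ≠ L i) (b : ι → Γ) {f : ι → X → ℝ} (hf : ∀ i, UnitBdd (f i))
    (hn : IsBoxNull μ φ (s.card + 1) (f i₀)) :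
    Tendsto (fun N => sqNormAverage μ φ (insert i₀ s) (fun i u => L i u + b i) f (Φ N)) atTop
      (𝓝 0) := by
  obtain ⟨cs, hcs, hcs0, H⟩ := exists_directions_of_linear h hΦ i₀ s L h0 hL
  refine LimsupLE.tendsto_zero (fun ε hε => ?_) fun N => sqNormAverage_nonneg _ _ _ _
  have hε' : 0 < ε ^ 2 ^ s.card / 2 := by positivity
  obtain ⟨K, hK, hlt⟩ := hn cs hcs hcs0 _ hε'
  filter_upwards [H b f hf K hK _ hε'] with N hN
  rw [zero_add]
  exact le_of_pow_le_pow_left₀ (by positivity) hε.le (hN.trans (by linarith))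

end Linear

/-! ### Polynomial maps between abelian groups -/

/-- `p` is a polynomial map of degree less than `D`: all its `D`-fold differences vanish. -/
def DegLT {G Γ : Type*} [AddCommGroup G] [AddCommGroup Γ] : ℕ → (G → Γ) → Prop
  | 0, p => ∀ u, p u = 0
  | D + 1, p => ∀ v, DegLT D fun u => p (u + v) - p u

namespace DegLT

variable {G Γ : Type*} [AddCommGroup G] [AddCommGroup Γ] {p q : G → Γ} {D : ℕ}

lemma zero_fun (D : ℕ) : DegLT D fun _ : G => (0 : Γ) := by
  induction D with
  | zero => exact fun _ => rfl
  | succ D ih => intro v; simpa using ih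

lemma add (hp : DegLT D p) (hq : DegLT D q) : DegLT D fun u => p u + q u := by
  induction D generalizing p q with
  | zero => intro u; simp [hp u, hq u]
  | succ D ih =>
    intro v
    simpa only [add_sub_add_comm] using ih (hp v) (hq v)

lemma neg (hp : DegLT D p) : DegLT D fun u => -p u := by
  induction D generalizing p with
  | zero => intro u; simp [hp u]
  | succ D ih =>
    intro v
    simpa only [neg_sub, neg_sub_neg] using ih (hp v)

lemma sub (hp : DegLT D p) (hq : DegLT D q) : DegLT D fun u => p u - q u := by
  simpa only [sub_eq_add_neg] using hp.add hq.neg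

lemma sub_comm (h : DegLT D fun u => p u - q u) : DegLT D fun u => q u - p u := by
  simpa only [neg_sub] using h.neg

lemma sub_trans {r : G → Γ} (h : DegLT D fun u => p u - q u) (h' : DegLT D fun u => q u - r u) :
    DegLT D fun u => p u - r u := by
  simpa only [sub_add_sub_cancel] using h.add h'

lemma of_sub (h : DegLT D fun u => p u - q u) (hq : DegLT D q) : DegLT D p := by
  simpa only [sub_add_cancel] using h.add hq

lemma succ (hp : DegLT D p) : DegLT (D + 1) p := by
  induction D generalizing p with
  | zero => intro v u; simp [hp _]
  | succ D ih => exact fun v => ih (hp v)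

lemma mono {D' : ℕ} (h : D ≤ D') (hp : DegLT D p) : DegLT D' p := by
  induction h with
  | refl => exact hp
  | step _ ih => exact ih.succ

lemma translate (hp : DegLT D p) (a : G) : DegLT D fun u => p (u + a) := by
  induction D generalizing p with
  | zero => exact fun u => hp _
  | succ D ih =>
    intro v
    simpa only [add_right_comm] using ih (hp v)

lemma of_translate {a : G} (hp : DegLT D fun u => p (u + a)) : DegLT D p := by
  simpa only [neg_add_cancel_right] using hp.translate (-a)

lemma translate_sub (hp : DegLT (D + 1) p) (a b : G) : DegLT D fun u => p (u + a) - p (u + b) := by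
  have := (hp (a - b)).translate b
  simpa only [add_assoc, add_sub_cancel] using this

lemma translate_sub_self (hp : DegLT (D + 1) p) (a : G) : DegLT D fun u => p (u + a) - p u := hp a

lemma eq_apply_zero (hp : DegLT 1 p) (u : G) : p u = p 0 := by
  simpa [sub_eq_zero] using hp u 0

lemma one_of_const {c : Γ} (h : ∀ u, p u = c) : DegLT 1 p := fun v u => by simp [h]

lemma exists_linear (hp : DegLT 2 p) : ∃ (L : G →+ Γ) (b : Γ), ∀ u, p u = L u + b := by
  refine ⟨AddMonoidHom.mk' (fun u => p u - p 0) fun a b => ?_, p 0, fun u => by simp⟩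
  have := (hp b).eq_apply_zero a
  simp only [zero_add] at this
  rw [sub_eq_iff_eq_add] at this
  rw [this]
  abel

lemma of_nsmul [IsAddTorsionFree Γ] {n : ℕ} (hn : n ≠ 0) (h : DegLT D fun u => n • p u) :
    DegLT D p := by
  induction D generalizing p with
  | zero => exact fun u => (nsmul_eq_zero_iff_right hn).1 (h u)
  | succ D ih =>
    intro v
    exact ih (by simpa only [nsmul_sub] using h v)

/-- Telescoping: the successive differences along `v` are translates of the first one, and a
translation changes it only by something of degree less than `D`. -/
lemma nsmul_translate_sub (hp : DegLT (D + 2) p) (v : G) (n : ℕ) :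
    DegLT D fun u => (p (u + n • v) - p u) - n • (p (u + v) - p u) := by
  induction n with
  | zero => simpa using zero_fun D
  | succ n ih =>
    convert ih.add ((hp v).translate_sub_self (n • v)) using 2 with u
    rw [add_smul, one_smul, add_smul, one_smul, add_assoc]
    abel

/-- If the difference of `p` in the direction `v` has the maximal possible degree, then so have the
differences of `p` in the direction of the multiples of `v`. -/
lemma of_nsmul_translate_sub [IsAddTorsionFree Γ] (hp : DegLT (D + 2) p) {v : G} {n n' : ℕ}
    (hn : n ≠ n') (h : DegLT D fun u => p (u + n • v) - p (u + n' • v)) :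
    DegLT D fun u => p (u + v) - p u := by
  wlog hlt : n' < n generalizing n n'
  · exact this hn.symm h.sub_comm (by omega)
  obtain ⟨k, rfl⟩ := Nat.exists_eq_add_of_lt hlt
  have h1 : DegLT D fun u => p (u + (k + 1) • v) - p u := by
    refine of_translate (a := n' • v) ?_
    convert h using 4 with u
    rw [add_assoc u, ← add_smul]
    rfl
  -- Modulo degree less than `D`, the difference over `k + 1` steps is `k + 1` times the difference
  -- over one step; torsion-freeness permits the division.
  refine of_nsmul (n := k + 1) (by omega) ?_
  simpa using h1.sub (hp.nsmul_translate_sub v (k + 1))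

end DegLT

/-! ### Weights of polynomial families -/

section Weight

variable {G Γ ι : Type*} [AddCommGroup G] [AddCommGroup Γ]

/-- In the family `(p i)` with `i ∈ t`, there are at most `w e` classes of polynomials of degree
`e`, two polynomials of degree `e` being equivalent if their difference has smaller degree. -/
def HasWeight {N : ℕ} (w : Fin (N + 1) → ℕ) (t : Finset ι) (p : ι → G → Γ) : Prop :=
  ∀ e : Fin (N + 1), ∃ R : Finset (G → Γ), R.card ≤ w e ∧
    ∀ i ∈ t, ¬ DegLT e (p i) → DegLT (e + 1) (p i) → ∃ r ∈ R, DegLT e fun u => p i u - r u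

/-- The weight after a step of the induction which eliminates a class of degree `e`. -/
def reducedWeight {N : ℕ} (w : Fin (N + 1) → ℕ) (e : Fin (N + 1)) (s : ℕ) : Fin (N + 1) → ℕ :=
  fun j => if e < j then w j else if j = e then w e - 1 else s

/-- The relation `>` on indices makes the highest degree decisive, so arbitrary growth below `e` is
harmless. -/
lemma reducedWeight_lex {N : ℕ} {w : Fin (N + 1) → ℕ} {e : Fin (N + 1)} (he : w e ≠ 0) (s : ℕ) :
    Pi.Lex (· > ·) (@fun _ x y => x < y) (reducedWeight w e s) w :=
  ⟨e, fun j hj => by simp [reducedWeight, show e < j from hj], by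
    simp only [reducedWeight, lt_irrefl, if_false, if_true]; omega⟩

/-- The family of differences that arises in a van der Corput step. -/
def vdcFamily (p : ι → G → Γ) (m : ι) (a b : G) : ι ⊕ ι → G → Γ :=
  Sum.elim (fun i u => p i (u + a) - p m (u + b)) (fun i u => p i (u + b) - p m (u + b))

/-- Subtracting the minimal-degree `p m` leaves the classes of degree above `e` unchanged. In degree
`e` it translates the classes by `p m`, so the class of `p m` itself falls to lower degree and
disappears. In lower degrees the number of members is a sufficient bound. -/
lemma HasWeight.vdcFamily {N : ℕ} {w : Fin (N + 1) → ℕ} {t : Finset ι} {p : ι → G → Γ}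
    (hw : HasWeight w t p) {m : ι} (hm : m ∈ t) {e : Fin (N + 1)} (hm1 : DegLT (e + 1) (p m))
    (hmin : ∀ i ∈ t, ¬ DegLT e (p i)) (a b : G) {t' : Finset (ι ⊕ ι)}
    (ht' : t' ⊆ t.disjSum t) {s : ℕ} (hs : t'.card ≤ s) :
    w e ≠ 0 ∧ HasWeight (reducedWeight w e s) t' (vdcFamily p m a b) := by
  classical
  obtain ⟨R, hR, hRt⟩ := hw e
  obtain ⟨rm, hrm, hrm'⟩ := hRt m hm (hmin m hm) hm1
  refine ⟨fun h => ?_, fun j => ?_⟩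
  · rw [h, Nat.le_zero, Finset.card_eq_zero] at hR
    simp [hR] at hrm
  have hform : ∀ x ∈ t', ∃ i ∈ t, ∃ a', ∀ u, _root_.vdcFamily p m a b x u
      = p i (u + a') - p m (u + b) := by
    intro x hx
    rcases Finset.mem_disjSum.1 (ht' hx) with ⟨i, hi, rfl⟩ | ⟨i, hi, rfl⟩
    · exact ⟨i, hi, a, fun u => rfl⟩
    · exact ⟨i, hi, b, fun u => rfl⟩
  rcases lt_trichotomy e j with hj | rfl | hj
  · obtain ⟨R, hR, hRt⟩ := hw j
    refine ⟨R, by simpa [reducedWeight, hj] using hR, fun x hx h1 h2 => ?_⟩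
    obtain ⟨i, hi, a', hq⟩ := hform x hx
    rw [show _root_.vdcFamily p m a b x = fun u => p i (u + a') - p m (u + b) from funext hq]
      at h1 h2 ⊢
    have hmj : DegLT j (p m) := hm1.mono (by exact_mod_cast hj)
    have h3 : DegLT (j + 1) (p i) := (h2.of_sub (hmj.succ.translate b)).of_translate
    have h4 : ¬ DegLT j (p i) := fun h4 => h1 ((h4.translate a').sub (hmj.translate b))
    obtain ⟨r, hr, hr'⟩ := hRt i hi h4 h3
    refine ⟨r, hr, ?_⟩
    convert ((h3.translate_sub_self a').add hr').sub (hmj.translate b) using 2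
    module
  · refine ⟨(R.filter fun r => ¬ DegLT e fun u => p m u - r u).image fun r u => r u - p m u,
      ?_, fun x hx h1 h2 => ?_⟩
    · refine Finset.card_image_le.trans ?_
      have : (R.filter fun r => ¬ DegLT e fun u => p m u - r u).card < R.card :=
        Finset.card_lt_card (Finset.filter_ssubset.2 ⟨rm, hrm, by simpa using hrm'⟩)
      simp only [reducedWeight, lt_irrefl, if_false, if_true]
      omega
    · obtain ⟨i, hi, a', hq⟩ := hform x hx
      rw [show _root_.vdcFamily p m a b x = fun u => p i (u + a') - p m (u + b) from funext hq]
        at h1 h2 ⊢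
      have h3 : DegLT (e + 1) (p i) := (h2.of_sub (hm1.translate b)).of_translate
      obtain ⟨r, hr, hr'⟩ := hRt i hi (hmin i hi) h3
      have h5 : DegLT e fun u => (p i (u + a') - p m (u + b)) - (p i u - p m u) := by
        convert (h3.translate_sub_self a').sub (hm1.translate_sub_self b) using 2
        abel
      refine ⟨fun u => r u - p m u, Finset.mem_image.2 ⟨r, Finset.mem_filter.2
        ⟨hr, fun h => h1 (h5.of_sub (hr'.sub_trans h.sub_comm))⟩, rfl⟩, ?_⟩
      convert h5.add hr' using 2
      module
  · refine ⟨t'.image (_root_.vdcFamily p m a b), Finset.card_image_le.trans ?_, fun x hx _ _ =>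
      ⟨_, Finset.mem_image_of_mem _ hx, by simpa using DegLT.zero_fun _⟩⟩
    simpa [reducedWeight, hj.not_gt, hj.ne] using hs

end Weight

/-! ### Induction on the weight -/

/-- In the family `(p i)` with `i ∈ t`, the polynomial `p i₀` has the maximal degree `D`, where
`1 ≤ D ≤ N`, and differs from every other member by a nonconstant polynomial. -/
structure IsLeading {G Γ ι : Type*} [AddCommGroup G] [AddCommGroup Γ] (N D : ℕ) (t : Finset ι)
    (p : ι → G → Γ) (i₀ : ι) : Prop where
  mem : i₀ ∈ t
  one_le : 1 ≤ D
  le : D ≤ N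
  degLT : ∀ i ∈ t, DegLT (D + 1) (p i)
  not_degLT : ¬ DegLT D (p i₀)
  sub_ne : ∀ i ∈ t, i ≠ i₀ → ¬ DegLT 1 fun u => p i₀ u - p i u

/-- The choice of the polynomial `p m` (of degree `e`) to be subtracted in a van der Corput step;
the new family has maximal degree `D'`. -/
lemma IsLeading.exists_pivot {G Γ ι : Type*} [AddCommGroup G] [AddCommGroup Γ]
    [IsAddTorsionFree Γ] {N D : ℕ} {t : Finset ι} {p : ι → G → Γ} {i₀ : ι}
    (hp : IsLeading N D t p i₀) (hD : 2 ≤ D) (ht : ∀ i ∈ t, ¬ DegLT 1 (p i)) {v : G}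
    (hv : ¬ DegLT (D - 1) fun u => p i₀ (u + v) - p i₀ u) :
    ∃ m ∈ t, ∃ e : Fin (N + 1), DegLT (e + 1) (p m) ∧ (∀ i ∈ t, ¬ DegLT e (p i)) ∧
      ∃ D', 1 ≤ D' ∧ D' ≤ N ∧ ∀ a b : G,
        (∀ x ∈ t.disjSum t, DegLT (D' + 1) (vdcFamily p m a b x)) ∧
        ∀ n n' : ℕ, n ≠ n' → ¬ DegLT D' (vdcFamily p m (n • v) (n' • v) (Sum.inl i₀)) := by
  classical
  -- If some member is not equivalent to `p i₀` in degree `D`, the pivot is one of least degree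
  -- among these; subtracting it leaves the tracked polynomial in degree `D`. Otherwise all members
  -- have degree `D` and the same top part; the pivot is `i₀`, and the new maximal degree is `D -
  -- 1`.
  by_cases hex : ∃ i ∈ t, ¬ DegLT D fun u => p i₀ u - p i u
  · have hex' : ∃ e, ∃ m ∈ t, (¬ DegLT D fun u => p i₀ u - p m u) ∧ DegLT (e + 1) (p m) := by
      obtain ⟨i, hi, hi'⟩ := hex
      exact ⟨D, i, hi, hi', hp.degLT i hi⟩
    set e := Nat.find hex' with he
    obtain ⟨m, hm, hm0, hm1⟩ := Nat.find_spec hex'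
    have heD : e ≤ D := by
      obtain ⟨i, hi, hi'⟩ := hex
      exact Nat.find_min' hex' ⟨i, hi, hi', hp.degLT i hi⟩
    have he1 : e ≠ 0 := fun h0 => ht m hm (by rw [← he, h0] at hm1; exact hm1)
    refine ⟨m, hm, ⟨e, by have := hp.le; omega⟩, hm1, fun i hi hie => ?_, D, hp.one_le, hp.le,
      fun a b => ⟨fun x hx => ?_, fun n n' _ h => hm0 ?_⟩⟩
    · simp only at hie
      by_cases hi0 : DegLT D fun u => p i₀ u - p i u
      · exact hp.not_degLT (hi0.of_sub (hie.mono heD))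
      · have hlt : e - 1 < Nat.find hex' := by omega
        exact Nat.find_min hex' hlt ⟨i, hi, hi0, by rwa [Nat.sub_add_cancel (by omega)]⟩
    · rcases Finset.mem_disjSum.1 hx with ⟨i, hi, rfl⟩ | ⟨i, hi, rfl⟩
      · exact ((hp.degLT i hi).translate a).sub ((hp.degLT m hm).translate b)
      · exact ((hp.degLT i hi).translate b).sub ((hp.degLT m hm).translate b)
    · have h1 := (hp.degLT i₀ hp.mem).translate_sub_self (n • v)
      have h2 := (hp.degLT m hm).translate_sub_self (n' • v)
      exact (h1.sub_comm.sub_trans h).sub_trans h2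
  · push Not at hex
    obtain ⟨E, rfl⟩ := Nat.exists_eq_add_of_le hD
    have hE : 2 + E - 1 = E + 1 := by omega
    rw [hE] at hv
    rw [show 2 + E = E + 1 + 1 by omega] at hex
    have hdeg : ∀ i ∈ t, DegLT (E + 1 + 2) (p i) := by
      have := hp.degLT
      rwa [show 2 + E + 1 = E + 1 + 2 by omega] at this
    refine ⟨i₀, hp.mem, ⟨2 + E, by have := hp.le; omega⟩, hp.degLT i₀ hp.mem, fun i hi hie => ?_,
      E + 1, by omega, by have := hp.le; omega, fun a b => ⟨fun x hx => ?_, fun n n' hn h => ?_⟩⟩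
    · simp only [show 2 + E = E + 1 + 1 by omega] at hie
      have := hp.not_degLT
      rw [show 2 + E = E + 1 + 1 by omega] at this
      exact this ((hex i hi).of_sub hie)
    · have key : ∀ i ∈ t, ∀ a', DegLT (E + 1 + 1) fun u => p i (u + a') - p i₀ (u + b) :=
        fun i hi a' => ((hex i hi).sub_comm.translate a').sub_trans
          ((hdeg i₀ hp.mem).translate_sub a' b)
      rcases Finset.mem_disjSum.1 hx with ⟨i, hi, rfl⟩ | ⟨i, hi, rfl⟩
      · exact key i hi a
      · exact key i hi b
    · exact hv ((hdeg i₀ hp.mem).of_nsmul_translate_sub hn h)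

section Induction

variable {G Γ ι X : Type*} [AddCommGroup G] [AddCommGroup Γ] [MeasurableSpace X] {μ : Measure X}
  [IsProbabilityMeasure μ] {φ : Γ → X → X}

lemma sqNormAverage_le_of_subset [DecidableEq ι] (h : IsErgodicAction μ φ) {f : ι → X → ℝ}
    (hf : ∀ i, UnitBdd (f i)) {t t' : Finset ι} (htt : t' ⊆ t) {p : ι → G → Γ}
    (hc : ∀ i ∈ t, i ∉ t' → DegLT 1 (p i)) (Φ : Finset G) :
    sqNormAverage μ φ t p f Φ ≤ sqNormAverage μ φ t' p f Φ := by
  suffices H : ∀ s : Finset ι, Disjoint s t' → (∀ i ∈ s, DegLT 1 (p i)) →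
      sqNormAverage μ φ (s ∪ t') p f Φ ≤ sqNormAverage μ φ t' p f Φ by
    have := H (t \ t') Finset.sdiff_disjoint
      fun i hi => hc i (Finset.mem_sdiff.1 hi).1 (Finset.mem_sdiff.1 hi).2
    rwa [Finset.sdiff_union_of_subset htt] at this
  intro s
  induction s using Finset.induction_on with
  | empty => intro _ _; simp
  | insert m s hm ih =>
    intro hd hs
    rw [Finset.disjoint_insert_left] at hd
    rw [Finset.insert_union]
    exact (sqNormAverage_insert_le h hf (by simp [hm, hd.1])
      (hs m (Finset.mem_insert_self m s)).eq_apply_zero Φ).trans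
      (ih hd.2 fun i hi => hs i (Finset.mem_insert_of_mem hi))

/-- A van der Corput step for polynomial families. -/
lemma tendsto_sqNormAverage_of_vdcFamily [DecidableEq ι] (h : IsErgodicAction μ φ)
    {Φ : ℕ → Finset G} (hΦ : IsFolnerSequence Φ) {t : Finset ι} {p : ι → G → Γ} {f : ι → X → ℝ}
    (hf : ∀ i, UnitBdd (f i)) (m : ι) (v : G) {C : ℕ} {good : ℕ → ℕ → Prop}
    (hgood : ∀ n n', good n n' → Tendsto (fun N => sqNormAverage μ φ (t.disjSum t)
      (vdcFamily p m (n • v) (n' • v)) (Sum.elim f f) (Φ N)) atTop (𝓝 0))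
    (hbad : ∀ H : ℕ, ∃ B : Finset (ℕ × ℕ), B.card ≤ C * H ∧
      ∀ n < H, ∀ n' < H, ¬ good n n' → (n, n') ∈ B) :
    Tendsto (fun N => sqNormAverage μ φ t p f (Φ N)) atTop (𝓝 0) := by
  classical
  refine LimsupLE.tendsto_zero (fun ε hε => ?_) fun N => sqNormAverage_nonneg _ _ _ _
  -- At most `C * H` of the `H * H` pairs are bad, each contributing at most `1`, so together they
  -- cost less than `ε / 2`.
  obtain ⟨H, hH⟩ := exists_nat_gt (C / (ε / 2))
  have hH0 : (0 : ℝ) < H := lt_of_le_of_lt (by positivity) hH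
  obtain ⟨B, hB, hB'⟩ := hbad H
  set Q := Finset.range H ×ˢ Finset.range H with hQ
  set x : ℕ × ℕ → ℕ → ℝ := fun q N => (1 / ((Φ N).card : ℝ)) * ∑ u ∈ Φ N,
    ∫ y, (∏ i ∈ t, f i (φ (p i (u + q.1 • v)) y)) * ∏ i ∈ t, f i (φ (p i (u + q.2 • v)) y) ∂μ
    with hx
  have hfu : ∀ y, UnitBdd (Sum.elim f f y) := by
    rintro (i | i)
    exacts [hf i, hf i]
  have hxe : ∀ q N, x q N = (1 / ((Φ N).card : ℝ)) * ∑ u ∈ Φ N, ∫ y, 1 *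
      ∏ z ∈ t.disjSum t, Sum.elim f f z (φ (vdcFamily p m (q.1 • v) (q.2 • v) z u) y) ∂μ := by
    intro q N
    simp only [hx]
    congr 1
    refine Finset.sum_congr rfl fun u _ => ?_
    have := h.integral_prod_shift (t.disjSum t) hfu
      (Sum.elim (fun i => p i (u + q.1 • v)) fun i => p i (u + q.2 • v)) (p m (u + q.2 • v))
    simp only [Finset.prod_disjSum, Sum.elim_inl, Sum.elim_inr] at this
    simp only [one_mul, Finset.prod_disjSum, Sum.elim_inl, Sum.elim_inr, vdcFamily]
    exact this
  have hx1 : ∀ q N, x q N ≤ 1 := fun q N => (le_abs_self _).trans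
    (abs_average_integral_le (Φ N) fun u => (UnitBdd.prodShift h hf t _).mul
      (UnitBdd.prodShift h hf t _))
  have hx2 : ∀ q N, x q N ^ 2 ≤ sqNormAverage μ φ (t.disjSum t)
      (vdcFamily p m (q.1 • v) (q.2 • v)) (Sum.elim f f) (Φ N) := fun q N => by
    rw [hxe]
    exact sq_average_integral_mul_le (Φ N) (UnitBdd.const (by simp))
      fun u => UnitBdd.prodShift h hfu _ _
  have hlim : ∀ q ∈ Q, LimsupLE (x q) (if q ∈ B then 1 else 0) := by
    intro q hq
    split_ifs with hqB
    · exact (LimsupLE.of_tendsto tendsto_const_nhds).mono (Eventually.of_forall (hx1 q))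
    · have hg : good q.1 q.2 := by
        by_contra hg
        rw [hQ, Finset.mem_product, Finset.mem_range, Finset.mem_range] at hq
        exact hqB (hB' q.1 hq.1 q.2 hq.2 hg)
      have h0 := squeeze_zero (fun N => sq_nonneg (x q N)) (hx2 q) (hgood _ _ hg)
      have h1 : Tendsto (fun N => √(x q N ^ 2)) atTop (𝓝 0) := by simpa using h0.sqrt
      refine (LimsupLE.of_tendsto h1).mono (Eventually.of_forall fun N => ?_)
      rw [Real.sqrt_sq_eq_abs]
      exact le_abs_self _
  have hav := ((LimsupLE.average Q hlim).add_of_tendsto (hΦ.tendsto_sum_defect H v))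
    _ (half_pos hε)
  filter_upwards [hav] with N hN
  have hvdc := integral_sq_average_le (μ := μ) (Φ N)
    (fun u => UnitBdd.prodShift h hf t fun i => p i u) v (H := H) (by rintro rfl; simp at hH0)
  refine (hvdc.trans hN).trans ?_
  have hcard : (1 / (Q.card : ℝ)) * ∑ q ∈ Q, (if q ∈ B then (1 : ℝ) else 0) ≤ ε / 2 := by
    rw [Finset.sum_boole, hQ, Finset.card_product, Finset.card_range, div_mul_eq_mul_div, one_mul,
      div_le_iff₀ (by push_cast; positivity)]
    have h1 : ((Finset.filter (· ∈ B) Q).card : ℝ) ≤ C * H := by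
      have : (Finset.filter (· ∈ B) Q).card ≤ B.card :=
        Finset.card_le_card fun q hq => (Finset.mem_filter.1 hq).2
      exact_mod_cast this.trans hB
    rw [div_lt_iff₀ (half_pos hε)] at hH
    push_cast
    nlinarith
  linarith

/-- For all but few pairs of multiples of `v` a member of the family that is tracked stays
essentially different from the other members. -/
lemma exists_card_bad_le {t : Finset ι} {p : ι → G → Γ} {i₀ : ι} {v : G}
    (hv : ∀ n n' : ℕ, n ≠ n' → ¬ DegLT 1 fun u => p i₀ (u + n • v) - p i₀ (u + n' • v)) (H : ℕ) :
    ∃ B : Finset (ℕ × ℕ), B.card ≤ t.card * H ∧ ∀ n < H, ∀ n' < H,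
      (¬ ∀ i ∈ t, ¬ DegLT 1 fun u => p i₀ (u + n • v) - p i (u + n' • v)) → (n, n') ∈ B := by
  classical
  set bad : ℕ × ℕ → ι → Prop :=
    fun q i => DegLT 1 fun u => p i₀ (u + q.1 • v) - p i (u + q.2 • v) with hbad
  refine ⟨(Finset.range H ×ˢ Finset.range H).filter fun q => ∃ i ∈ t, bad q i, ?_,
    fun n hn n' hn' h => ?_⟩
  · rcases t.eq_empty_or_nonempty with rfl | ⟨j, -⟩
    · simp
    have hch : ∀ q : ℕ × ℕ, ∃ i, (∃ i ∈ t, bad q i) → i ∈ t ∧ bad q i := fun q => by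
      by_cases hq : ∃ i ∈ t, bad q i
      · obtain ⟨i, hi⟩ := hq
        exact ⟨i, fun _ => hi⟩
      · exact ⟨j, fun hq' => absurd hq' hq⟩
    choose c hc using hch
    rw [← Finset.card_range H, ← Finset.card_product]
    -- For given `i` and `n'` at most one `n` is bad: two of them would make `p i₀` shifted by `n₁ •
    -- v` and by `n₂ • v` differ by a constant.
    refine Finset.card_le_card_of_injOn (fun q => (c q, q.2)) ?_ ?_
    · intro q hq
      obtain ⟨hq, hq'⟩ := Finset.mem_filter.1 hq
      exact Finset.mem_coe.2 (Finset.mem_product.2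
        ⟨(hc q hq').1, by simpa using (Finset.mem_product.1 hq).2⟩)
    · rintro ⟨n₁, n⟩ h1 ⟨n₂, n'⟩ h2 heq
      simp only [Prod.mk.injEq] at heq
      obtain ⟨hcc, rfl⟩ := heq
      have b1 := (hc _ (Finset.mem_filter.1 h1).2).2
      have b2 := (hc _ (Finset.mem_filter.1 h2).2).2
      rw [← hcc] at b2
      by_contra hne
      exact hv n₁ n₂ (fun e => hne (by rw [e])) (b1.sub_trans b2.sub_comm)
  · push Not at h
    exact Finset.mem_filter.2 ⟨by simp [hn, hn'], h⟩

end Induction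

/-- Nullness of order `k` of the leading function forces the averages along the family to tend to
zero, for all families of weight `w` with at most `s` members. -/
def ControlsFamilies.{u} (G Γ : Type) [AddCommGroup G] [AddCommGroup Γ] {N : ℕ}
    (w : Fin (N + 1) → ℕ) (s k : ℕ) : Prop :=
  ∀ (ι : Type) [DecidableEq ι] (t : Finset ι) (p : ι → G → Γ) (i₀ : ι) (D : ℕ), t.card ≤ s →
    HasWeight w t p → IsLeading N D t p i₀ →
    ∀ (X : Type u) [MeasurableSpace X] (μ : Measure X) [IsProbabilityMeasure μ] (φ : Γ → X → X),
      IsErgodicAction μ φ → ∀ Φ : ℕ → Finset G, IsFolnerSequence Φ →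
      ∀ f : ι → X → ℝ, (∀ i, UnitBdd (f i)) → IsBoxNull μ φ k (f i₀) →
        Tendsto (fun N => sqNormAverage μ φ t p f (Φ N)) atTop (𝓝 0)

/-- Supplies the nonzero direction needed to lower the order of nullness with `IsBoxNull.anti`. -/
lemma IsLeading.exists_ne_zero {G Γ ι : Type*} [AddCommGroup G] [AddCommGroup Γ] {N D : ℕ}
    {t : Finset ι} {p : ι → G → Γ} {i₀ : ι} (hp : IsLeading N D t p i₀) : ∃ c : Γ, c ≠ 0 := by
  by_contra hc
  push Not at hc
  refine hp.not_degLT ?_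
  rw [show p i₀ = fun _ => 0 from funext fun u => hc _]
  exact DegLT.zero_fun D

lemma tendsto_sqNormAverage_of_degree_one {G Γ ι X : Type*} [AddCommGroup G] [AddCommGroup Γ]
    [DecidableEq ι] [MeasurableSpace X] {μ : Measure X} [IsProbabilityMeasure μ] {φ : Γ → X → X}
    (h : IsErgodicAction μ φ) {Φ : ℕ → Finset G} (hΦ : IsFolnerSequence Φ) {N : ℕ} {t : Finset ι}
    {p : ι → G → Γ} {i₀ : ι} (hp : IsLeading N 1 t p i₀) {f : ι → X → ℝ}
    (hf : ∀ i, UnitBdd (f i)) (hn : IsBoxNull μ φ t.card (f i₀)) :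
    Tendsto (fun N => sqNormAverage μ φ t p f (Φ N)) atTop (𝓝 0) := by
  have hL : ∀ i, ∃ (L : G →+ Γ) (b : Γ), i ∈ t → ∀ u, p i u = L u + b := fun i => by
    by_cases hi : i ∈ t
    · obtain ⟨L, b, hLb⟩ := (hp.degLT i hi).exists_linear
      exact ⟨L, b, fun _ => hLb⟩
    · exact ⟨0, 0, fun hi' => absurd hi' hi⟩
  choose L b hLb using hL
  have hins : insert i₀ (t.erase i₀) = t := Finset.insert_erase hp.mem
  have h0 : L i₀ ≠ 0 := fun h0 => hp.not_degLT
    (DegLT.one_of_const (c := b i₀) fun u => by simp [hLb i₀ hp.mem u, h0])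
  have hne : ∀ i ∈ t.erase i₀, L i₀ ≠ L i := fun i hi heq => by
    rw [Finset.mem_erase] at hi
    refine hp.sub_ne i hi.2 hi.1 (DegLT.one_of_const (c := b i₀ - b i) fun u => ?_)
    rw [hLb i₀ hp.mem u, hLb i hi.2 u, heq]
    abel
  have := tendsto_sqNormAverage_linear h hΦ h0 hne b hf
    (by rwa [Finset.card_erase_add_one hp.mem])
  rw [hins] at this
  refine this.congr fun N => ?_
  unfold sqNormAverage
  congr 1
  ext x
  congr 2
  exact Finset.sum_congr rfl fun u _ => Finset.prod_congr rfl fun i hi => by rw [hLb i hi u]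

/-- Well-founded induction on the weight, with `s` universally quantified because a van der Corput
step may double the number of members. The degree `e` of the pivot is not known in advance but takes
only `N + 1` values, so a supremum over `e` covers every case; the summand `s + 1` covers families
of degree one. -/
theorem exists_controlsFamilies.{u} (G Γ : Type) [AddCommGroup G] [AddCommGroup Γ]
    [IsAddTorsionFree Γ] {N : ℕ} (w : Fin (N + 1) → ℕ) :
    ∀ s, ∃ k, 1 ≤ k ∧ ControlsFamilies.{u} G Γ w s k := by
  classical
  have wf : WellFounded (Pi.Lex (· > ·) (@fun (_ : Fin (N + 1)) (x y : ℕ) => x < y)) :=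
    Pi.Lex.wellFounded _ fun _ => wellFounded_lt
  induction w using wf.induction with
  | _ w ih =>
  intro s
  have hk : ∀ e : Fin (N + 1), ∃ k, w e ≠ 0 →
      ControlsFamilies.{u} G Γ (reducedWeight w e (2 * s)) (2 * s) k := fun e => by
    by_cases he : w e = 0
    · exact ⟨0, fun h => absurd he h⟩
    · obtain ⟨k, -, hk⟩ := ih _ (reducedWeight_lex he (2 * s)) (2 * s)
      exact ⟨k, fun _ => hk⟩
  choose k hk using hk
  refine ⟨s + 1 + Finset.univ.sup k, by omega, ?_⟩
  intro ι _ t p i₀ D hts hw hp X _ μ _ φ h Φ hΦ f hf hn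
  obtain ⟨c, hc⟩ := hp.exists_ne_zero
  have hanti : ∀ k' ≤ s + 1 + Finset.univ.sup k, IsBoxNull μ φ k' (f i₀) := fun k' hk' =>
    IsBoxNull.anti h (hf i₀) hc hk' hn
  obtain hD | hD : D = 1 ∨ 2 ≤ D := by have := hp.one_le; omega
  · subst hD
    exact tendsto_sqNormAverage_of_degree_one h hΦ hp hf (hanti _ (by omega))
  set t₁ := t.filter fun i => ¬ DegLT 1 (p i) with ht₁
  have ht₁t : t₁ ⊆ t := Finset.filter_subset _ _
  have hpt₁ : IsLeading N D t₁ p i₀ :=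
    ⟨Finset.mem_filter.2 ⟨hp.mem, fun h1 => hp.not_degLT (h1.mono hp.one_le)⟩, hp.one_le, hp.le,
      fun i hi => hp.degLT i (ht₁t hi), hp.not_degLT, fun i hi => hp.sub_ne i (ht₁t hi)⟩
  have hw₁ : HasWeight w t₁ p := fun e => by
    obtain ⟨R, hR, hRt⟩ := hw e
    exact ⟨R, hR, fun i hi => hRt i (ht₁t hi)⟩
  suffices H : Tendsto (fun N => sqNormAverage μ φ t₁ p f (Φ N)) atTop (𝓝 0) from
    squeeze_zero (fun N => sqNormAverage_nonneg _ _ _ _) (fun N => sqNormAverage_le_of_subset h hf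
      ht₁t (fun i hi hi' => by simpa [ht₁, hi] using hi') (Φ N)) H
  obtain ⟨v, hv⟩ : ∃ v, ¬ DegLT (D - 1) fun u => p i₀ (u + v) - p i₀ u := by
    by_contra hv
    push Not at hv
    refine hp.not_degLT ?_
    rw [← Nat.sub_add_cancel hp.one_le]
    exact hv
  obtain ⟨m, hm, e, hm1, hmin, D', hD'1, hD'N, hD'⟩ :=
    hpt₁.exists_pivot hD (fun i hi => (Finset.mem_filter.1 hi).2) hv
  have hcard : ∀ t' ⊆ t₁.disjSum t₁, t'.card ≤ 2 * s := fun t' ht' => by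
    have h1 := Finset.card_le_card ht'
    have h2 := Finset.card_le_card ht₁t
    rw [Finset.card_disjSum] at h1
    omega
  have hvn : ∀ n n' : ℕ, n ≠ n' →
      ¬ DegLT 1 fun u => p i₀ (u + n • v) - p i₀ (u + n' • v) := fun n n' hnn hd => by
    have h1 := (hp.degLT i₀ hp.mem)
    rw [show D + 1 = D - 1 + 2 by omega] at h1
    exact hv (h1.of_nsmul_translate_sub hnn (hd.mono (by omega)))
  -- Goodness separates the tracked polynomial from the members shifted by `n' • v`; from those
  -- shifted by `n • v` it is separated by hypothesis. The choice `i = i₀` also forces `n ≠ n'`.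
  refine tendsto_sqNormAverage_of_vdcFamily h hΦ hf m v (C := t₁.card)
    (good := fun n n' => ∀ i ∈ t₁, ¬ DegLT 1 fun u => p i₀ (u + n • v) - p i (u + n' • v))
    (fun n n' hg => ?_) fun H => exists_card_bad_le hvn H
  have hnn : n ≠ n' := by
    rintro rfl
    exact hg i₀ hpt₁.mem (by simpa using DegLT.zero_fun 1)
  set q := vdcFamily p m (n • v) (n' • v) with hq
  set t' := (t₁.disjSum t₁).filter fun x => ¬ DegLT 1 (q x) with ht'
  have ht't : t' ⊆ t₁.disjSum t₁ := Finset.filter_subset _ _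
  obtain ⟨hwe, hw'⟩ := hw₁.vdcFamily hm hm1 hmin (n • v) (n' • v) ht't (hcard t' ht't)
  have hlead : ¬ DegLT D' (q (Sum.inl i₀)) := (hD' 0 0).2 n n' hnn
  have hp' : IsLeading N D' t' q (Sum.inl i₀) := by
    refine ⟨Finset.mem_filter.2 ⟨Finset.inl_mem_disjSum.2 hpt₁.mem,
      fun h1 => hlead (h1.mono hD'1)⟩, hD'1, hD'N, fun x hx => (hD' _ _).1 x (ht't hx), hlead,
      fun x hx hne => ?_⟩
    rcases Finset.mem_disjSum.1 (ht't hx) with ⟨i, hi, rfl⟩ | ⟨i, hi, rfl⟩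
    · intro h1
      refine hpt₁.sub_ne i hi (fun e => hne (by rw [e])) (DegLT.of_translate (a := n • v) ?_)
      simpa [hq, vdcFamily] using h1
    · intro h1
      refine hg i hi ?_
      simpa [hq, vdcFamily] using h1
  have hfu : ∀ y, UnitBdd (Sum.elim f f y) := by
    rintro (i | i)
    exacts [hf i, hf i]
  refine squeeze_zero (fun N => sqNormAverage_nonneg _ _ _ _)
    (fun N => sqNormAverage_le_of_subset h hfu ht't (fun x hx hx' => ?_) (Φ N)) ?_
  · simpa only [ht', Finset.mem_filter, hx, true_and, not_not] using hx'
  exact hk e hwe (ι ⊕ ι) t' q (Sum.inl i₀) D' (hcard t' ht't) hw' hp' X μ φ h Φ hΦ _ hfu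
    (hanti _ ((Finset.le_sup (Finset.mem_univ e)).trans (by omega)))

/-! ### Degrees of polynomial maps on `ℤ^d` -/

namespace DegLT

variable {G : Type*} [AddCommGroup G]

lemma comp_hom {G' Γ : Type*} [AddCommGroup G'] [AddCommGroup Γ] {p : G → Γ} {D : ℕ}
    (hp : DegLT D p) (g : G' →+ G) : DegLT D fun u => p (g u) := by
  induction D generalizing p with
  | zero => exact fun u => hp _
  | succ D ih =>
    intro v
    simpa only [map_add] using ih (hp (g v))

lemma hom_comp {Γ Γ' : Type*} [AddCommGroup Γ] [AddCommGroup Γ'] {p : G → Γ} {D : ℕ}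
    (hp : DegLT D p) (g : Γ →+ Γ') : DegLT D fun u => g (p u) := by
  induction D generalizing p with
  | zero => intro u; simp [hp u]
  | succ D ih =>
    intro v
    simpa only [map_sub] using ih (hp v)

lemma of_hom_comp {Γ Γ' : Type*} [AddCommGroup Γ] [AddCommGroup Γ'] {p : G → Γ} {D : ℕ}
    {g : Γ →+ Γ'} (hg : Function.Injective g) (hp : DegLT D fun u => g (p u)) : DegLT D p := by
  induction D generalizing p with
  | zero => exact fun u => (map_eq_zero_iff g hg).1 (hp u)
  | succ D ih =>
    intro v
    exact ih (by simpa only [map_sub] using hp v)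

lemma pi {κ : Type*} {Γ : κ → Type*} [∀ j, AddCommGroup (Γ j)] {p : G → ∀ j, Γ j} {D : ℕ}
    (hp : ∀ j, DegLT D fun u => p u j) : DegLT D p := by
  induction D generalizing p with
  | zero => exact fun u => funext fun j => hp j u
  | succ D ih => exact fun v => ih fun j => hp j v

lemma finsetSum {Γ κ : Type*} [AddCommGroup Γ] {D : ℕ} (s : Finset κ) {p : κ → G → Γ}
    (hp : ∀ i ∈ s, DegLT D (p i)) : DegLT D fun u => ∑ i ∈ s, p i u := by
  classical
  induction s using Finset.induction_on with
  | empty => simpa using zero_fun D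
  | insert i s hi ih =>
    simp only [Finset.sum_insert hi]
    exact (hp i (by simp)).add (ih fun j hj => hp j (by simp [hj]))

variable {R : Type*} [CommRing R]

/-- Induction on `a + b` with the Leibniz rule for differences. -/
lemma mul {a b : ℕ} {p q : G → R} (hp : DegLT (a + 1) p) (hq : DegLT (b + 1) q) :
    DegLT (a + b + 1) fun u => p u * q u := by
  obtain ⟨n, hn⟩ : ∃ n, a + b = n := ⟨_, rfl⟩
  induction n generalizing a b p q with
  | zero =>
    obtain ⟨rfl, rfl⟩ : a = 0 ∧ b = 0 := by omega
    exact one_of_const fun u => by rw [hp.eq_apply_zero u, hq.eq_apply_zero u]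
  | succ n ih =>
    intro v
    have h1 : DegLT (a + b) fun u => (p (u + v) - p u) * q (u + v) := by
      cases a with
      | zero =>
        have : ∀ u, p (u + v) - p u = 0 := hp v
        simpa only [this, zero_mul] using zero_fun _
      | succ a =>
        rw [show a + 1 + b = a + b + 1 by omega]
        exact ih (hp v) (hq.translate v) (by omega)
    have h2 : DegLT (a + b) fun u => p u * (q (u + v) - q u) := by
      cases b with
      | zero =>
        have : ∀ u, q (u + v) - q u = 0 := hq v
        simpa only [this, mul_zero] using zero_fun _
      | succ b => exact ih hp (hq v) (by omega)
    have e : (fun u => p (u + v) * q (u + v) - p u * q u)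
        = fun u => (p (u + v) - p u) * q (u + v) + p u * (q (u + v) - q u) := by
      ext u
      ring
    rw [e]
    exact h1.add h2

lemma pow {p : G → R} (hp : DegLT 2 p) (n : ℕ) : DegLT (n + 1) fun u => p u ^ n := by
  induction n with
  | zero => exact one_of_const fun u => pow_zero _
  | succ n ih => simpa only [pow_succ] using ih.mul hp

lemma finsetProd {κ : Type*} (s : Finset κ) {p : κ → G → R} {n : κ → ℕ}
    (hp : ∀ i ∈ s, DegLT (n i + 1) (p i)) : DegLT (∑ i ∈ s, n i + 1) fun u => ∏ i ∈ s, p i u := by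
  classical
  induction s using Finset.induction_on with
  | empty => exact one_of_const fun u => Finset.prod_empty
  | insert i s hi ih =>
    simp only [Finset.prod_insert hi, Finset.sum_insert hi]
    exact (hp i (by simp)).mul (ih fun j hj => hp j (by simp [hj]))

lemma fwdDiff_iter_eq_zero {Γ : Type*} [AddCommGroup Γ] {p : G → Γ} {D : ℕ} (hp : DegLT D p)
    (v : G) : (fwdDiff v)^[D] p = 0 := by
  induction D generalizing p with
  | zero => exact funext hp
  | succ D ih =>
    rw [Function.iterate_succ_apply]
    exact ih (hp v)

lemma eq_zero_of_pow_mul {n : ℕ} {c : ℚ} (h : DegLT n fun m : ℤ => (m : ℚ) ^ n * c) : c = 0 := by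
  have h1 := congrFun (h.fwdDiff_iter_eq_zero 1) 0
  have h2 := congrFun (fwdDiff_iter_eq_factorial (R := ℚ) (n := n)) 0
  rw [fwdDiff_iter_eq_sum_shift] at h1 h2
  have h3 : (n.factorial : ℚ) * c = 0 := by
    rw [Pi.zero_apply] at h1
    rw [← h1]
    change ((n.factorial : ℚ → ℚ) 0) * c = _
    rw [← h2, Finset.sum_mul]
    refine Finset.sum_congr rfl fun k _ => ?_
    simp [mul_assoc]
  exact (mul_eq_zero.1 h3).resolve_left (by exact_mod_cast n.factorial_ne_zero)

end DegLT

section MvPolynomial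

open MvPolynomial

variable {d : ℕ}

lemma degLT_eval (p : MvPolynomial (Fin d) ℚ) :
    DegLT (p.totalDegree + 1) fun u : Fin d → ℤ => eval (fun i => (u i : ℚ)) p := by
  simp only [eval_eq']
  refine DegLT.finsetSum _ fun m hm => ?_
  have hX : ∀ i : Fin d, DegLT 2 fun u : Fin d → ℤ => (u i : ℚ) := fun i v =>
    DegLT.one_of_const (c := (v i : ℚ)) fun u => by simp
  have h1 := DegLT.finsetProd Finset.univ (n := fun i => m i)
    fun i _ => (hX i).pow (m i)
  have hle : ∑ i, m i ≤ p.totalDegree := by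
    rw [← Finsupp.degree_eq_sum]
    exact le_totalDegree hm
  have h2 := (DegLT.one_of_const (p := fun _ : Fin d → ℤ => p.coeff m) fun _ => rfl).mul h1
  exact h2.mono (by omega)

lemma eval_mul_of_isHomogeneous {p : MvPolynomial (Fin d) ℚ} {n : ℕ} (hp : p.IsHomogeneous n)
    (a : ℚ) (x : Fin d → ℚ) : eval (fun i => a * x i) p = a ^ n * eval x p := by
  simp only [eval_eq', Finset.mul_sum]
  refine Finset.sum_congr rfl fun m hm => ?_
  have hdeg : ∑ i, m i = n := by
    rw [← Finsupp.degree_eq_sum]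
    by_contra hne
    exact mem_support_iff.1 hm (hp.coeff_eq_zero hne)
  simp only [mul_pow, Finset.prod_mul_distrib, Finset.prod_pow_eq_pow_sum, hdeg]
  ring

/-- If it failed, the top homogeneous part `g` would also have vanishing `n`-fold differences. Along
the line `m ↦ m • v` it equals `m ^ n * g v`, whose `n`-th difference is `n! * g v`; so `g` vanishes
at all integer points and is zero. -/
lemma not_degLT_eval {p : MvPolynomial (Fin d) ℚ} (hp : p ≠ 0) :
    ¬ DegLT p.totalDegree fun u : Fin d → ℤ => eval (fun i => (u i : ℚ)) p := by
  intro h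
  set n := p.totalDegree with hn
  set g := homogeneousComponent n p with hg
  have hhom : g.IsHomogeneous n := homogeneousComponent_isHomogeneous n p
  have hg0 : g ≠ 0 := by
    intro hg0
    have hc : ∃ m ∈ p.support, m.degree = n := by
      obtain ⟨m, hm, hmn⟩ := Finset.exists_mem_eq_sup p.support (support_nonempty.2 hp)
        fun m : Fin d →₀ ℕ => m.sum fun _ e => e
      exact ⟨m, hm, hmn.symm⟩
    obtain ⟨m, hm, hmn⟩ := hc
    have := coeff_homogeneousComponent n p m
    rw [← hg, hg0, if_pos hmn] at this
    exact mem_support_iff.1 hm (by simpa using this.symm)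
  have hsub : DegLT n fun u : Fin d → ℤ => eval (fun i => (u i : ℚ)) g := by
    have hsum := sum_homogeneousComponent p
    rw [← hn, Finset.sum_range_succ] at hsum
    have e : (fun u : Fin d → ℤ => eval (fun i => (u i : ℚ)) g) = fun u =>
        eval (fun i => (u i : ℚ)) p
          - ∑ k ∈ Finset.range n, eval (fun i => (u i : ℚ)) (homogeneousComponent k p) := by
      ext u
      have := congrArg (eval fun i => (u i : ℚ)) hsum
      rw [map_add, map_sum] at this
      rw [← this, hg, add_sub_cancel_left]
    rw [e]
    refine h.sub (DegLT.finsetSum _ fun k hk => (degLT_eval _).mono ?_)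
    have := (homogeneousComponent_isHomogeneous k p).totalDegree_le
    have := Finset.mem_range.1 hk
    omega
  refine hg0 (funext_set (fun _ => Set.range ((↑) : ℤ → ℚ))
    (fun _ => Set.infinite_range_of_injective Int.cast_injective) fun x hx => ?_)
  choose v hv using fun i => hx i (Set.mem_univ i)
  obtain rfl : (fun i => (v i : ℚ)) = x := funext hv
  rw [map_zero]
  refine DegLT.eq_zero_of_pow_mul (n := n) ?_
  have := hsub.comp_hom (zmultiplesHom (Fin d → ℤ) v)
  simpa [eval_mul_of_isHomogeneous hhom] using this

end MvPolynomial

namespace IntPolyMap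

variable {d : ℕ} (p : IntPolyMap d)

lemma degLT_toFun : DegLT (p.degree + 1) p.toFun := by
  refine DegLT.of_hom_comp (g := Int.castAddHom ℚ) Int.cast_injective ?_
  simpa [← p.eval_eq, degree] using degLT_eval p.poly

lemma not_degLT_toFun (hp : p.degree ≠ 0) : ¬ DegLT p.degree p.toFun := by
  intro h
  refine not_degLT_eval (p := p.poly) (fun h0 => hp (by simp [degree, h0])) ?_
  simpa [p.eval_eq, degree] using h.hom_comp (Int.castAddHom ℚ)

end IntPolyMap

lemma IntPolyMap.degree_le_familyDegree {d r l : ℕ} (P : Fin r → Fin l → IntPolyMap d) (i : Fin r)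
    (j : Fin l) : (P i j).degree ≤ familyDegree P :=
  (Finset.le_sup (f := fun j => (P i j).degree) (Finset.mem_univ j)).trans
    (Finset.le_sup (f := fun i => Finset.univ.sup fun j => (P i j).degree) (Finset.mem_univ i))

/-- The first row of a standard family is leading. -/
lemma IsStandardFamily.isLeading {d r l : ℕ} [NeZero r] {P : Fin r → Fin l → IntPolyMap d}
    (hP : IsStandardFamily P) :
    IsLeading (familyDegree P) (familyDegree P) Finset.univ
      (fun i u j => (P i j).toFun u) (0 : Fin r) := by
  have hdeg : ∀ i j, DegLT (familyDegree P + 1) (P i j).toFun := fun i j =>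
    (P i j).degLT_toFun.mono (by have := IntPolyMap.degree_le_familyDegree P i j; omega)
  have hpos : 1 ≤ familyDegree P := by
    by_contra hlt
    obtain ⟨j, hj⟩ := hP.row_ne_zero 0
    have h1 := hdeg 0 j
    rw [show familyDegree P + 1 = 1 by omega] at h1
    refine hP.ne_const 0 j ⟨(P 0 j).toFun 0, fun h0 => hj (funext fun u => ?_), h1.eq_apply_zero⟩
    rw [h1.eq_apply_zero u, h0]
    rfl
  refine ⟨Finset.mem_univ _, hpos, le_rfl, fun i _ => DegLT.pi (hdeg i), fun h => ?_,
    fun i _ hi h => ?_⟩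
  · obtain ⟨j, hj⟩ := hP.exists_degree_eq
    refine (P 0 j).not_degLT_toFun (by omega) ?_
    rw [hj]
    exact h.hom_comp (Pi.evalAddMonoidHom (fun _ : Fin l => ℤ) j)
  · obtain ⟨j, hj⟩ := hP.rows_distinct 0 i hi.symm
    have h1 := h.hom_comp (Pi.evalAddMonoidHom (fun _ : Fin l => ℤ) j)
    have h2 : ∀ u, (P 0 j).toFun u - (P i j).toFun u = (P 0 j).toFun 0 - (P i j).toFun 0 :=
      h1.eq_apply_zero
    refine hP.sub_ne_const 0 j i j ⟨_, fun h0 => hj (funext fun u => ?_), h2⟩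
    exact sub_eq_zero.1 ((h2 u).trans h0)

/-! ### The action of a system -/

lemma prod_ofFn_zpow_add {A : Type*} [Group A] {l : ℕ} (σ : Fin l → A)
    (hσ : ∀ i j, Commute (σ i) (σ j)) (a b : Fin l → ℤ) :
    (List.ofFn fun j => σ j ^ (a j + b j)).prod
      = (List.ofFn fun j => σ j ^ a j).prod * (List.ofFn fun j => σ j ^ b j).prod := by
  induction l with
  | zero => simp
  | succ l ih =>
    simp only [List.ofFn_succ, List.prod_cons]
    rw [ih (fun j => σ j.succ) (fun i j => hσ _ _) (fun j => a j.succ) fun j => b j.succ, zpow_add]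
    have hc : Commute (σ 0 ^ b 0) (List.ofFn fun j : Fin l => σ j.succ ^ a j.succ).prod := by
      refine Commute.list_prod_right _ _ fun x hx => ?_
      obtain ⟨j, rfl⟩ := List.mem_ofFn.1 hx
      exact (hσ 0 j.succ).zpow_zpow _ _
    rw [mul_assoc, ← mul_assoc (σ 0 ^ b 0), hc.eq]
    simp only [mul_assoc]

lemma IsFreelyGeneratedTotallyErgodic.isErgodicAction {X : Type*} [MeasurableSpace X]
    {μ : Measure X} {l : ℕ} {T : Fin l → X ≃ᵐ X} (hT : IsFreelyGeneratedTotallyErgodic μ T) :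
    IsErgodicAction μ fun c => ⇑(genPow T c) where
  zero_apply x := by
    have : genPow T 0 = 1 := by simp [genPow, List.prod_eq_one]
    simp [this]
  add_apply a b x := by
    have h := prod_ofFn_zpow_add (fun j => ((T j).toEquiv : Equiv.Perm X))
      (fun i j => Equiv.ext (hT.commute i j)) a b
    exact congrArg (fun σ : Equiv.Perm X => σ x) h
  measurePreserving c := by
    refine List.prod_induction (fun σ : Equiv.Perm X => MeasurePreserving σ μ μ)
      (fun a b ha hb => ha.comp hb) (MeasurePreserving.id μ) fun σ hσ => ?_
    obtain ⟨j, rfl⟩ := List.mem_ofFn.1 hσ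
    have hpow : ∀ (S : Equiv.Perm X), MeasurePreserving S μ μ → ∀ n : ℕ,
        MeasurePreserving (S ^ n : Equiv.Perm X) μ μ := fun S hS n => by
      rw [Equiv.Perm.coe_pow]
      exact hS.iterate n
    have hinv : MeasurePreserving ((T j).toEquiv⁻¹ : Equiv.Perm X) μ μ :=
      (hT.measurePreserving j).symm (T j)
    cases c j with
    | ofNat n => exact hpow _ (hT.measurePreserving j) n
    | negSucc n =>
      rw [zpow_negSucc, ← inv_pow]
      exact hpow _ hinv (n + 1)
  ergodic := hT.ergodic

open scoped Pointwise in
lemma isFolnerSequence_of_isAddFoelner {G : Type*} [AddCommGroup G] [MeasurableSpace G]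
    [MeasurableSingletonClass G] {Φ : ℕ → Finset G}
    (hΦ : IsAddFoelner G Measure.count atTop fun N => (Φ N : Set G)) : IsFolnerSequence Φ where
  nonempty := by
    filter_upwards [hΦ.eventually_meas_ne_zero] with N hN
    rw [Finset.nonempty_iff_ne_empty]
    rintro h
    simp [h] at hN
  tendsto_defect g := by
    classical
    have h := (ENNReal.tendsto_toReal ENNReal.zero_ne_top).comp (hΦ.tendsto_meas_vadd_symmDiff g)
    rw [ENNReal.toReal_zero] at h
    refine h.congr fun N => ?_
    have e : symmDiff (g +ᵥ (Φ N : Set G)) (Φ N : Set G)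
        = ((symmDiff ((Φ N).map (addLeftEmbedding g)) (Φ N) : Finset G) : Set G) := by
      rw [Finset.coe_symmDiff, Finset.coe_map]
      rfl
    simp only [Function.comp_apply]
    rw [e, Measure.count_apply_finset, Measure.count_apply_finset, translationDefect,
      ENNReal.toReal_div, ENNReal.toReal_natCast, ENNReal.toReal_natCast]

/-! ### Essentially bounded functions -/

lemma exists_unitBdd_ae_eq {X : Type*} [MeasurableSpace X] {μ : Measure X} {f : X → ℝ}
    (hf : MemLp f ∞ μ) :
    ∃ C : ℝ, 0 < C ∧ ∃ g : X → ℝ, UnitBdd g ∧ f =ᵐ[μ] fun x => C * g x := by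
  obtain ⟨h, hm, hfh⟩ := hf.1
  set C := (eLpNormEssSup f μ).toReal + 1 with hC
  have hC0 : 0 < C := by positivity
  refine ⟨C, hC0, fun x => max (-1) (min 1 (h x / C)), ⟨?_, fun x => ?_⟩, ?_⟩
  · exact measurable_const.max (measurable_const.min (hm.measurable.div_const C))
  · exact abs_le.2 ⟨le_max_left _ _, max_le (by norm_num) (min_le_left _ _)⟩
  · have hlt : eLpNormEssSup f μ ≠ ∞ := by
      have := hf.2
      rw [eLpNorm_exponent_top] at this
      exact this.ne
    filter_upwards [hfh, ae_le_eLpNormEssSup (f := f) (μ := μ)] with x hx hx'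
    have hb : |f x| ≤ C := by
      have := ENNReal.toReal_mono hlt hx'
      rw [toReal_enorm, Real.norm_eq_abs] at this
      linarith
    rw [← hx]
    have h1 := (div_le_one hC0).2 (abs_le.1 hb).2
    have h2 : -1 ≤ f x / C := by
      rw [le_div_iff₀ hC0]
      linarith [(abs_le.1 hb).1]
    rw [min_eq_right h1, max_eq_right h2]
    field_simp

lemma cubeProd_ae_eq {X : Type*} [MeasurableSpace X] [StandardBorelSpace X]
    {μ : ProbabilityMeasure X} (S : X → X) {f g : X → ℝ} (h : f =ᵐ[(μ : Measure X)] g) (k : ℕ) :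
    cubeProd f k =ᵐ[(hostKraMeasure μ S k : Measure (Cube X k))] cubeProd g k := by
  induction k with
  | zero => exact h
  | succ k ih =>
    obtain ⟨h1, h2⟩ := relIndepSquare_marginals (MeasurableSpace.invariants (cubeMap S k))
      (hostKraMeasure μ S k) (MeasurableSpace.invariants_le _)
    have i1 := ae_of_ae_map measurable_fst.aemeasurable (h1.symm ▸ ih)
    have i2 := ae_of_ae_map measurable_snd.aemeasurable (h2.symm ▸ ih)
    filter_upwards [i1, i2] with x hx1 hx2
    exact congrArg₂ (· * ·) hx1 hx2

lemma cubeProd_const_mul {X : Type*} (C : ℝ) (f : X → ℝ) (k : ℕ) (x : Cube X k) :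
    cubeProd (fun y => C * f y) k x = C ^ 2 ^ k * cubeProd f k x := by
  have h : ∀ (k : ℕ) (x : Cube X k), cubeProd (fun _ : X => C) k x = C ^ 2 ^ k := by
    intro k
    induction k with
    | zero => intro x; simp [cubeProd]
    | succ k ih => intro x; simp only [cubeProd, ih]; ring
  rw [cubeProd_mul, h]

lemma integral_cubeProd_eq_zero_of_hostKraSeminorm {X : Type*} [MeasurableSpace X]
    [StandardBorelSpace X] {μ : ProbabilityMeasure X} {S : X → X} {f g : X → ℝ} {C : ℝ}
    (hC : 0 < C) (hg : UnitBdd g) (hfg : f =ᵐ[(μ : Measure X)] fun x => C * g x) {k : ℕ}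
    (hk : 1 ≤ k) (h0 : hostKraSeminorm μ S k f = 0) :
    ∫ x, cubeProd g k x ∂(hostKraMeasure μ S k : Measure (Cube X k)) = 0 := by
  have e : ∫ x, cubeProd f k x ∂(hostKraMeasure μ S k : Measure (Cube X k))
      = C ^ 2 ^ k * ∫ x, cubeProd g k x ∂(hostKraMeasure μ S k : Measure (Cube X k)) := by
    rw [integral_congr_ae (cubeProd_ae_eq S hfg k), ← integral_const_mul]
    simp only [cubeProd_const_mul]
  -- Nonnegativity uses `1 ≤ k` and is essential: the real power of a negative number can be zero,
  -- as with exponent `1 / 2`.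
  have hnn : 0 ≤ ∫ x, cubeProd g k x ∂(hostKraMeasure μ S k : Measure (Cube X k)) := by
    obtain ⟨k, rfl⟩ := Nat.exists_eq_add_of_le' hk
    rw [integral_cubeProd_succ S hg]
    exact integral_nonneg fun _ => sq_nonneg _
  rw [hostKraSeminorm, e, Real.rpow_eq_zero_iff_of_nonneg (by positivity)] at h0
  exact (mul_eq_zero.1 h0.1).resolve_left (by positivity)

lemma eLpNorm_two_eq {X : Type*} [MeasurableSpace X] {μ : Measure X} {f : X → ℝ}
    (hf : MemLp f 2 μ) : eLpNorm f 2 μ = ENNReal.ofReal √(∫ x, f x ^ 2 ∂μ) := by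
  rw [hf.eLpNorm_eq_integral_rpow_norm two_ne_zero ENNReal.ofNat_ne_top, Real.sqrt_eq_rpow]
  simp

theorem propositionJ {d r l : ℕ} [NeZero r] (P : Fin r → Fin l → IntPolyMap d)
    (hP : IsStandardFamily P) :
    ∃ k : ℕ, 1 ≤ k ∧
      ∀ (X : Type*) [MeasurableSpace X] [StandardBorelSpace X] (μ : ProbabilityMeasure X)
        (T : Fin l → X ≃ᵐ X), IsFreelyGeneratedTotallyErgodic (μ : Measure X) T →
      ∀ c : Fin l → ℤ, c ≠ 0 →
      ∀ f : Fin r → X → ℝ, (∀ i, MemLp (f i) ∞ (μ : Measure X)) →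
        hostKraSeminorm μ (genPow T c) k (f 0) = 0 →
      ∀ Φ : ℕ → Finset (Fin d → ℤ),
        IsAddFoelner (Fin d → ℤ) Measure.count atTop (fun N => (Φ N : Set (Fin d → ℤ))) →
        limsup (fun N => eLpNorm (polyAverage T P f (Φ N)) 2 (μ : Measure X)) atTop = 0 := by
  classical
  set p : Fin r → (Fin d → ℤ) → Fin l → ℤ := fun i u j => (P i j).toFun u with hp
  -- A family of `r` rows has at most `r` classes in each degree, so the constant weight `r` is
  -- admissible and `k` depends only on `d`, `l`, `r` and the degree of the family.
  obtain ⟨k, hk1, hk⟩ := exists_controlsFamilies (Fin d → ℤ) (Fin l → ℤ)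
    (N := familyDegree P) (fun _ => r) r
  refine ⟨k, hk1, ?_⟩
  intro X _ _ μ T hT c _ f hf hsem Φ hΦ
  have h := hT.isErgodicAction
  have hΦ' := isFolnerSequence_of_isAddFoelner hΦ
  choose C hC g hg hfg using fun i => exists_unitBdd_ae_eq (hf i)
  have hnull : IsBoxNull (μ : Measure X) (fun c => ⇑(genPow T c)) k (g 0) :=
    isBoxNull_of_integral_cubeProd_eq_zero h (hg 0)
      (integral_cubeProd_eq_zero_of_hostKraSeminorm (hC 0) (hg 0) (hfg 0) hk1 hsem)
  have hw : HasWeight (fun _ : Fin (familyDegree P + 1) => r) Finset.univ p := fun e =>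
    ⟨Finset.univ.image p, Finset.card_image_le.trans (by simp), fun i hi _ _ =>
      ⟨p i, Finset.mem_image_of_mem p hi, by simpa using DegLT.zero_fun _⟩⟩
  have hlim := hk (Fin r) Finset.univ p 0 (familyDegree P) (by simp) hw hP.isLeading X
    (μ : Measure X) _ h Φ hΦ' g hg hnull
  have hae : ∀ N, polyAverage T P f (Φ N) =ᵐ[(μ : Measure X)] (∏ i, C i) • fun x =>
      (1 / ((Φ N).card : ℝ)) * ∑ u ∈ Φ N, ∏ i, g i (genPow T (p i u) x) := by
    intro N
    have h1 : ∀ (c : Fin l → ℤ) (i : Fin r),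
        ∀ᵐ x ∂(μ : Measure X), f i (genPow T c x) = C i * g i (genPow T c x) := fun c i =>
      (h.measurePreserving c).quasiMeasurePreserving.ae (hfg i)
    filter_upwards [ae_all_iff.2 fun c => ae_all_iff.2 fun i => h1 c i] with x hx
    simp only [polyAverage, hx, Finset.prod_mul_distrib, ← Finset.mul_sum, Pi.smul_apply,
      smul_eq_mul]
    exact mul_left_comm _ _ _
  have hnorm : ∀ N, eLpNorm (polyAverage T P f (Φ N)) 2 (μ : Measure X)
      = ‖∏ i, C i‖ₑ * ENNReal.ofReal √(sqNormAverage (μ : Measure X)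
        (fun c => ⇑(genPow T c)) Finset.univ p g (Φ N)) := by
    intro N
    rw [eLpNorm_congr_ae (hae N), eLpNorm_const_smul, eLpNorm_two_eq
      ((UnitBdd.average (Φ N) fun u _ => UnitBdd.prodShift h hg Finset.univ
        fun i => p i u).memLp _ 2)]
    rfl
  refine Tendsto.limsup_eq ?_
  simp only [hnorm]
  have h2 := ENNReal.Tendsto.const_mul (a := ‖∏ i, C i‖ₑ) (ENNReal.tendsto_ofReal hlim.sqrt)
    (Or.inr enorm_ne_top)
  simpa using h2
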